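/- Work over $\mathbb{C}$. Let $\mathcal{H}_{\mathbb{Z}}$ be the Heisenberg Lie algebra with basis $h_n$ ($n\in\mathbb{Z}$) and a central element $\mathbf 1$, with $[h_m,h_n]=m\,\delta_{m+n,0}\,\mathbf 1$. For $\lambda\in\mathbb{C}$ let $B_\lambda=\mathbb{C}[x_1,x_2,\dots]$ be the $\mathcal{H}_{\mathbb{Z}}$-module on which $h_n$ acts as $\partial_{x_n}$ and $h_{-n}$ as multiplication by $n x_n$ for $n\ge 1$, $h_0$ as the scalar $\lambda$, and $\mathbf 1$ as the identity. For odd fields $a(z)=\sum_{n\in\mathbb{Z}} a_n z^{-n-1}$ and $b(z)=\sum_{n\in\mathbb{Z}} b_n z^{-n-1}$ on a vector space (so that $a_nv=b_nv=0$ for $n\gg0$, for every vector $v$), let $:a(z)b(z):\;=\sum_{p,q\in\mathbb{Z}} :a_pb_q:\,z^{-p-q-2}$ with $:a_pb_q:\;=a_pb_q$ for $p<0$ and $:a_pb_q:\;=-b_qa_p$ for $p\ge 0$. Let $F^{\otimes\frac12}$ be the Fock space of the neutral fermion: the highest weight module of the Clifford algebra with generators $\phi_n$, $n\in\mathbb{Z}+\frac12$,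 and relations $\{\phi_m,\phi_n\}=\delta_{m,-n}1$, generated by a vacuum vector $|0\rangle$ subject to $\phi_n|0\rangle=0$ for $n>0$. Put $\phi(z)=\sum_{n\in\mathbb{Z}+1/2}\phi_nz^{-n-1/2}$ and let $h^D_n$ be the coefficient of $z^{-2n-1}$ in $\frac12:\phi(z)\phi(-z):$. For $m\in\mathbb{Z}$ let $F_{(m)}\subseteq F^{\otimes\frac12}$ be the span of the monomials $\phi_{-n_k-\frac12}\cdots\phi_{-n_1-\frac12}|0\rangle$, $n_k>\dots>n_1\ge0$, $k\ge0$, for which the number of odd $n_i$ minus the number of even $n_i$ equals $m$. Let $v_0=|0\rangle$ and, for $n>0$, $v_n=\phi_{-(2n-1)-\frac12}\cdots\phi_{-3-\frac12}\phi_{-1-\frac12}|0\rangle$ and $v_{-n}=\phi_{-(2n-2)-\frac12}\cdots\phi_{-2-\frac12}\phi_{-\frac12}|0\rangle$. Let $F^{\otimes1}$ be the Fock space of a pair of charged fermions: the highest weight module of the Clifford algebra with generators $\psi^\pm_n$, $n\in\mathbb{Z}$, and relations $\{\psi^+_m,\psi^-_n\}=\delta_{m+n,-1}1$, $\{\psi^+_m,\psi^+_n\}=\{\psi^-_m,\psi^-_n\}=0$,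 generated by a vacuum vector $|0\rangle$ subject to $\psi^\pm_n|0\rangle=0$ for $n\ge0$. Put $\psi^\pm(z)=\sum_n\psi^\pm_nz^{-n-1}$ and let $h^A_n$ be the coefficient of $z^{-n-1}$ in $:\psi^+(z)\psi^-(z):$. Then: 1. $[h^D_m,h^D_n]=m\,\delta_{m+n,0}\,1$ and $[h^A_m,h^A_n]=m\,\delta_{m+n,0}\,1$ for all $m,n\in\mathbb{Z}$. Thus $F^{\otimes\frac12}$ (via $h_n\mapsto h^D_n$, $\mathbf 1\mapsto 1$; this representation is $r_{D,H}$) and $F^{\otimes1}$ (via $h_n\mapsto h^A_n$, $\mathbf 1\mapsto 1$) are $\mathcal{H}_{\mathbb{Z}}$-modules. 2. Each $F_{(m)}$, $m\in\mathbb{Z}$, is an $\mathcal{H}_{\mathbb{Z}}$-submodule of $F^{\otimes\frac12}$, and $F^{\otimes\frac12}=\bigoplus_{m\in\mathbb{Z}}F_{(m)}$. 3. Each $F_{(m)}$ is an irreducible highest weight $\mathcal{H}_{\mathbb{Z}}$-module with highest weight vector $v_m$ of weight $m$: one has $0\ne v_m\in F_{(m)}$, $h_nv_m=0$ for $n>0$,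 $h_0v_m=m\,v_m$, and $v_m$ generates $F_{(m)}$ as an $\mathcal{H}_{\mathbb{Z}}$-module. 4. $F_{(m)}\cong B_m$ as $\mathcal{H}_{\mathbb{Z}}$-modules for every $m\in\mathbb{Z}$, hence $F^{\otimes\frac12}\cong\bigoplus_{m\in\mathbb{Z}}B_m$. 5. $F^{\otimes\frac12}\cong F^{\otimes1}$ as $\mathcal{H}_{\mathbb{Z}}$-modules. -/

import Mathlib

open scoped DirectSum

noncomputable section

/-! ### The Heisenberg Lie algebra -/

/-- The underlying space of the Heisenberg Lie algebra `H_ℤ`: the first component is spanned by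
the generators `h_n`, `n ∈ ℤ`, the second one by the central element. -/
def HeisZ : Type := (ℤ →₀ ℂ) × ℂ

namespace HeisZ

instance : AddCommGroup HeisZ := inferInstanceAs (AddCommGroup ((ℤ →₀ ℂ) × ℂ))
instance : Module ℂ HeisZ := inferInstanceAs (Module ℂ ((ℤ →₀ ℂ) × ℂ))

/-- The component in the span of the generators `h_n`. -/
def gen : HeisZ →ₗ[ℂ] (ℤ →₀ ℂ) := LinearMap.fst ℂ (ℤ →₀ ℂ) ℂ

/-- The central component. -/
def cen : HeisZ →ₗ[ℂ] ℂ := LinearMap.snd ℂ (ℤ →₀ ℂ) ℂ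

/-- The element with given components. -/
def mk (f : ℤ →₀ ℂ) (t : ℂ) : HeisZ := (f, t)

@[simp] theorem gen_mk (f : ℤ →₀ ℂ) (t : ℂ) : gen (mk f t) = f := rfl

@[simp] theorem cen_mk (f : ℤ →₀ ℂ) (t : ℂ) : cen (mk f t) = t := rfl

@[ext] theorem ext {x y : HeisZ} (h₁ : gen x = gen y) (h₂ : cen x = cen y) : x = y :=
  Prod.ext h₁ h₂

/-- The bilinear form with `h_m, h_n ↦ m δ_{m+n,0}`. -/
def cocycle : (ℤ →₀ ℂ) →ₗ[ℂ] (ℤ →₀ ℂ) →ₗ[ℂ] ℂ :=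
  Finsupp.linearCombination ℂ (fun m : ℤ => (m : ℂ) • Finsupp.lapply (-m))

theorem cocycle_single (m n : ℤ) (a b : ℂ) :
    cocycle (Finsupp.single m a) (Finsupp.single n b) =
      if m + n = 0 then a * (m * b) else 0 := by
  have : (n = -m) ↔ (m + n = 0) := by omega
  simp [cocycle, Finsupp.single_apply, this]

theorem cocycle_skew (f g : ℤ →₀ ℂ) : cocycle f g = -cocycle g f := by
  have h : cocycle = -cocycle.flip := by
    ext m n
    simp only [LinearMap.coe_comp, Function.comp_apply, Finsupp.lsingle_apply,
      LinearMap.neg_apply, LinearMap.flip_apply, cocycle_single]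
    by_cases hmn : m + n = 0
    · have hn : n = -m := by omega
      subst hn
      simp
    · have hnm : ¬ (n + m = 0) := by omega
      simp [hmn, hnm]
  exact congrArg (fun F => F f g) h

theorem cocycle_self (f : ℤ →₀ ℂ) : cocycle f f = 0 :=
  self_eq_neg.mp (cocycle_skew f f)

instance : Bracket HeisZ HeisZ := ⟨fun x y => mk 0 (cocycle (gen x) (gen y))⟩

theorem bracket_def (x y : HeisZ) : ⁅x, y⁆ = mk 0 (cocycle (gen x) (gen y)) := rfl

instance : LieRing HeisZ where
  add_lie x y z := by ext <;> simp [bracket_def]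
  lie_add x y z := by ext <;> simp [bracket_def]
  lie_self x := by ext <;> simp [bracket_def, cocycle_self]
  leibniz_lie x y z := by ext <;> simp [bracket_def]

instance : LieAlgebra ℂ HeisZ where
  lie_smul t x y := by ext <;> simp [bracket_def]

/-- The generator `h_n`. -/
def h (n : ℤ) : HeisZ := mk (Finsupp.single n 1) 0

/-- The central element, denoted `1` in `[h_m, h_n] = m δ_{m+n,0} 1`. -/
def c : HeisZ := mk 0 1

theorem lie_h (m n : ℤ) : ⁅h m, h n⁆ = if m + n = 0 then (m : ℂ) • c else 0 := by
  split_ifs with hmn <;> ext <;> simp [bracket_def, h, c, cocycle_single, hmn]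

end HeisZ

/-- The operators `op n` satisfy `[op m, op n] = m δ_{m+n,0} 1`. -/
def HeisRel {V : Type*} [AddCommGroup V] [Module ℂ V] (op : ℤ → Module.End ℂ V) : Prop :=
  ∀ m n : ℤ, op m * op n - op n * op m = if m + n = 0 then (m : ℂ) • (1 : Module.End ℂ V) else 0

/-- The linear map `H_ℤ → End V` with `h_n ↦ op n` and central element `↦ 1`. -/
def heisRep {V : Type*} [AddCommGroup V] [Module ℂ V] (op : ℤ → Module.End ℂ V) :
    HeisZ →ₗ[ℂ] Module.End ℂ V :=
  Finsupp.linearCombination ℂ op ∘ₗ HeisZ.gen +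
    LinearMap.toSpanSingleton ℂ (Module.End ℂ V) 1 ∘ₗ HeisZ.cen

theorem heisRep_apply {V : Type*} [AddCommGroup V] [Module ℂ V] (op : ℤ → Module.End ℂ V)
    (z : HeisZ) : heisRep op z =
      Finsupp.linearCombination ℂ op (HeisZ.gen z) + HeisZ.cen z • (1 : Module.End ℂ V) := rfl

theorem heisRep_lie {V : Type*} [AddCommGroup V] [Module ℂ V] (op : ℤ → Module.End ℂ V)
    (hop : HeisRel op) (x y : HeisZ) :
    heisRep op ⁅x, y⁆ = heisRep op x * heisRep op y - heisRep op y * heisRep op x := by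
  have key : ∀ f g : ℤ →₀ ℂ, HeisZ.cocycle f g • (1 : Module.End ℂ V) =
      Finsupp.linearCombination ℂ op f * Finsupp.linearCombination ℂ op g -
        Finsupp.linearCombination ℂ op g * Finsupp.linearCombination ℂ op f := by
    intro f g
    induction f using Finsupp.induction_linear with
    | zero => simp
    | add f₁ f₂ h₁ h₂ =>
      simp only [map_add, LinearMap.add_apply, add_smul, h₁, h₂, add_mul, mul_add]; abel
    | single m a =>
      induction g using Finsupp.induction_linear with
      | zero => simp
      | add g₁ g₂ h₁ h₂ => simp only [map_add, add_smul, h₁, h₂, add_mul, mul_add]; abel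
      | single n b =>
        have h := congrArg (fun A => (a * b) • A) (hop m n)
        simp only [smul_sub] at h
        rw [HeisZ.cocycle_single, Finsupp.linearCombination_single,
          Finsupp.linearCombination_single, smul_mul_smul_comm, smul_mul_smul_comm,
          mul_comm b a, h]
        split_ifs
        · rw [smul_smul]; congr 1; ring
        · simp
  have h0 : (heisRep op ⁅x, y⁆ : Module.End ℂ V) =
      HeisZ.cocycle (HeisZ.gen x) (HeisZ.gen y) • (1 : Module.End ℂ V) := by
    rw [heisRep_apply, HeisZ.bracket_def]; simp
  rw [h0, key, heisRep_apply, heisRep_apply]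
  simp only [add_mul, mul_add, smul_mul_assoc, mul_smul_comm, one_mul, mul_one]
  rw [smul_add, smul_add, smul_comm (HeisZ.cen x) (HeisZ.cen y)]
  abel

/-- The space `V`, regarded as an `H_ℤ`-module through `heisRep op`. -/
def HeisModule {V : Type*} [AddCommGroup V] [Module ℂ V] (op : ℤ → Module.End ℂ V)
    (_hop : HeisRel op) : Type _ := V

namespace HeisModule

variable {V : Type*} [AddCommGroup V] [Module ℂ V] (op : ℤ → Module.End ℂ V) (hop : HeisRel op)

instance : AddCommGroup (HeisModule op hop) := inferInstanceAs (AddCommGroup V)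
instance : Module ℂ (HeisModule op hop) := inferInstanceAs (Module ℂ V)

/-- The identity map of `V`. -/
def of : V ≃ₗ[ℂ] HeisModule op hop := LinearEquiv.refl ℂ V

instance : LieRingModule HeisZ (HeisModule op hop) where
  bracket x v := heisRep op x v
  add_lie x y v := congrArg (fun A : Module.End ℂ V => A v) (map_add (heisRep op) x y)
  lie_add x v w := (heisRep op x).map_add v w
  leibniz_lie x y v := by
    have h := congrArg (fun A : Module.End ℂ V => A v) (heisRep_lie op hop x y)
    change heisRep op x (heisRep op y v) =
      heisRep op ⁅x, y⁆ v + heisRep op y (heisRep op x v)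
    have h' : heisRep op ⁅x, y⁆ v =
      heisRep op x (heisRep op y v) - heisRep op y (heisRep op x v) := h
    rw [h', sub_add_cancel]

instance : LieModule ℂ HeisZ (HeisModule op hop) where
  smul_lie t x v := congrArg (fun A : Module.End ℂ V => A v) (map_smul (heisRep op) t x)
  lie_smul t x v := (heisRep op x).map_smul t v

theorem h_lie (n : ℤ) (v : V) : ⁅HeisZ.h n, of op hop v⁆ = of op hop (op n v) := by
  change (Finsupp.linearCombination ℂ op (Finsupp.single n 1) + (0 : ℂ) • (1 : Module.End ℂ V)) v
    = op n v
  simp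

theorem c_lie (v : V) : ⁅HeisZ.c, of op hop v⁆ = of op hop v := by
  change (Finsupp.linearCombination ℂ op 0 + (1 : ℂ) • (1 : Module.End ℂ V)) v = v
  simp

end HeisModule

/-- `v` generates `M` as a highest weight `H_ℤ`-module of highest weight `lam` and level one. -/
structure IsHeisHighestWeightVector {M : Type*} [AddCommGroup M] [Module ℂ M]
    [LieRingModule HeisZ M] [LieModule ℂ HeisZ M] (lam : ℂ) (v : M) : Prop where
  ne_zero : v ≠ 0
  annihilated : ∀ n : ℤ, 0 < n → ⁅HeisZ.h n, v⁆ = 0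
  weight : ⁅HeisZ.h 0, v⁆ = lam • v
  level : ⁅HeisZ.c, v⁆ = v
  generates : LieSubmodule.lieSpan ℂ HeisZ {v} = ⊤

/-! ### The bosonic modules `B_λ` -/

/-- The operators on `ℂ[x_1, x_2, …]`: `h_n ↦ ∂/∂x_n` and `h_{-n} ↦ n x_n` for `n ≥ 1`,
`h_0 ↦ lam`. -/
def bosonOp (lam : ℂ) : ℤ → Module.End ℂ (MvPolynomial ℕ+ ℂ)
  | Int.ofNat 0 => lam • 1
  | Int.ofNat (k + 1) => (MvPolynomial.pderiv k.succPNat).toLinearMap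
  | Int.negSucc k => ((k : ℂ) + 1) • LinearMap.mulLeft ℂ (MvPolynomial.X k.succPNat)

theorem bosonOp_rel (lam : ℂ) : HeisRel (bosonOp lam) := by
  intro m n
  have hinj : ∀ k l : ℕ, k.succPNat = l.succPNat ↔ k = l :=
    fun k l => ⟨fun h => Nat.succPNat_injective h, fun h => by rw [h]⟩
  have comm : ∀ k l : ℕ, ∀ p : MvPolynomial ℕ+ ℂ,
      MvPolynomial.pderiv k.succPNat (MvPolynomial.X l.succPNat * p) =
        (if k = l then p else 0) +
          MvPolynomial.X l.succPNat * MvPolynomial.pderiv k.succPNat p := by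
    intro k l p
    rw [Derivation.leibniz, MvPolynomial.pderiv_X]
    by_cases hkl : k = l
    · subst hkl; simp [add_comm]
    · have : l.succPNat ≠ k.succPNat := fun h => hkl ((hinj _ _).1 h).symm
      simp [hkl, this]
  refine LinearMap.ext fun p => ?_
  rcases m with (_ | k) | k <;> rcases n with (_ | l) | l
  · simp [bosonOp]
  · have : ¬ ((Int.ofNat 0) + Int.ofNat (l + 1) = 0) := by simp; omega
    simp only [this, if_false]
    simp [bosonOp]
  · have : ¬ ((Int.ofNat 0) + Int.negSucc l = 0) := by simp
    simp only [this, if_false]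
    change _ - _ = (0 : MvPolynomial ℕ+ ℂ)
    simp only [bosonOp, Module.End.mul_apply, LinearMap.smul_apply, Module.End.one_apply,
      map_smul]
    rw [smul_comm, sub_self]
  · have : ¬ (Int.ofNat (k + 1) + Int.ofNat 0 = 0) := by simp; omega
    simp only [this, if_false]
    simp [bosonOp]
  · have : ¬ (Int.ofNat (k + 1) + Int.ofNat (l + 1) = 0) := by simp; omega
    simp only [this, if_false]
    change MvPolynomial.pderiv k.succPNat (MvPolynomial.pderiv l.succPNat p) -
      MvPolynomial.pderiv l.succPNat (MvPolynomial.pderiv k.succPNat p) = 0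
    have hz : ⁅(MvPolynomial.pderiv k.succPNat : Derivation ℂ (MvPolynomial ℕ+ ℂ) _),
        (MvPolynomial.pderiv l.succPNat : Derivation ℂ (MvPolynomial ℕ+ ℂ) _)⁆ = 0 := by
      refine MvPolynomial.derivation_ext fun i => ?_
      rw [Derivation.commutator_apply, MvPolynomial.pderiv_X, MvPolynomial.pderiv_X]
      simp only [Pi.single_apply]
      split_ifs <;> simp
    have hp := congrArg (fun D : Derivation ℂ (MvPolynomial ℕ+ ℂ) (MvPolynomial ℕ+ ℂ) => D p) hz
    simpa only [Derivation.commutator_apply, Derivation.zero_apply] using hp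
  · change MvPolynomial.pderiv k.succPNat (((l : ℂ) + 1) • (MvPolynomial.X l.succPNat * p)) -
      ((l : ℂ) + 1) • (MvPolynomial.X l.succPNat * MvPolynomial.pderiv k.succPNat p) = _
    rw [Derivation.map_smul, comm, smul_add, add_sub_cancel_right]
    by_cases hkl : k = l
    · subst hkl
      have : Int.ofNat (k + 1) + Int.negSucc k = 0 := by simp [Int.negSucc_eq]
      simp only [this, if_true]
      simp
    · have : ¬ (Int.ofNat (k + 1) + Int.negSucc l = 0) := by simp [Int.negSucc_eq]; omega
      simp only [this, if_false]
      simp [hkl]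
  · have : ¬ (Int.negSucc k + Int.ofNat 0 = 0) := by simp
    simp only [this, if_false]
    change _ - _ = (0 : MvPolynomial ℕ+ ℂ)
    simp only [bosonOp, Module.End.mul_apply, LinearMap.smul_apply, Module.End.one_apply,
      map_smul]
    rw [smul_comm, sub_self]
  · change ((k : ℂ) + 1) • (MvPolynomial.X k.succPNat * MvPolynomial.pderiv l.succPNat p) -
      MvPolynomial.pderiv l.succPNat (((k : ℂ) + 1) • (MvPolynomial.X k.succPNat * p)) = _
    rw [Derivation.map_smul, comm, smul_add, sub_add_cancel_right]
    by_cases hkl : l = k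
    · subst hkl
      have : Int.negSucc l + Int.ofNat (l + 1) = 0 := by simp [Int.negSucc_eq]
      simp only [this, if_true, LinearMap.smul_apply, Module.End.one_apply, Int.cast_negSucc]
      rw [← neg_smul]
      push_cast
      rfl
    · have : ¬ (Int.negSucc k + Int.ofNat (l + 1) = 0) := by simp [Int.negSucc_eq]; omega
      simp only [this, if_false]
      simp [hkl]
  · have : ¬ (Int.negSucc k + Int.negSucc l = 0) := by simp [Int.negSucc_eq]; omega
    simp only [this, if_false]
    change ((k : ℂ) + 1) • (MvPolynomial.X k.succPNat *
        (((l : ℂ) + 1) • (MvPolynomial.X l.succPNat * p))) -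
      ((l : ℂ) + 1) • (MvPolynomial.X l.succPNat *
        (((k : ℂ) + 1) • (MvPolynomial.X k.succPNat * p))) = 0
    rw [mul_smul_comm, mul_smul_comm, smul_comm, mul_left_comm, sub_self]

/-- `B_lam`: the polynomial ring `ℂ[x_1, x_2, …]` as an `H_ℤ`-module. -/
abbrev BosonModule (lam : ℂ) : Type := HeisModule (bosonOp lam) (bosonOp_rel lam)

/-! ### Fields and normal ordered products -/

/-- A field `a(z) = ∑ a_n z^{-n-1}` on `V`. -/
structure QField (V : Type*) [AddCommGroup V] [Module ℂ V] where
  mode : ℤ → Module.End ℂ V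
  truncated : ∀ v : V, ∃ N : ℤ, ∀ n : ℤ, N ≤ n → mode n v = 0

namespace QField

variable {V : Type*} [AddCommGroup V] [Module ℂ V]

/-- The field `a(-z)`. -/
def reflect (a : QField V) : QField V where
  mode n := ((-1 : ℂ) ^ (-n - 1)) • a.mode n
  truncated v := by
    obtain ⟨N, hN⟩ := a.truncated v
    exact ⟨N, fun n hn => by simp [hN n hn]⟩

/-- The normal ordered product `:a_p b_q:` of modes of two odd fields. -/
def normalOrder (a b : QField V) (p q : ℤ) : Module.End ℂ V :=
  if p < 0 then a.mode p * b.mode q else -(b.mode q * a.mode p)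

theorem normalOrder_finite (a b : QField V) (N : ℤ) (v : V) :
    (Function.support fun p : ℤ => normalOrder a b p (N - 1 - p) v).Finite := by
  obtain ⟨A, hA⟩ := a.truncated v
  obtain ⟨B, hB⟩ := b.truncated v
  refine (Set.finite_Icc (min (N - 1 - B) 0) (max A 0)).subset fun p hp => ?_
  by_contra hmem
  apply hp
  rw [Set.mem_Icc, not_and_or, not_le, not_le] at hmem
  simp only [normalOrder]
  split_ifs with hp0
  · simp [hB (N - 1 - p) (by omega)]
  · simp [hA p (by omega)]

/-- The coefficient of `z^{-N-1}` in the normal ordered product `:a(z)b(z):` of two odd fields,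
`∑_{p+q=N-1} :a_p b_q:`; on every vector only finitely many terms are non-zero. -/
def normalProductMode (a b : QField V) (N : ℤ) : Module.End ℂ V where
  toFun v := ∑ᶠ p : ℤ, normalOrder a b p (N - 1 - p) v
  map_add' v w := by
    simp only [map_add]
    exact finsum_add_distrib (normalOrder_finite a b N v) (normalOrder_finite a b N w)
  map_smul' t v := by
    simp only [map_smul, RingHom.id_apply]
    exact (smul_finsum' t (normalOrder_finite a b N v)).symm

end QField

/-! ### Clifford algebras on modes and their Fock spaces -/

section Clifford

variable {ι : Type} (τ : ι → ι)

/-- The bilinear form on the span of symbols `e_i` with `e_i, e_j ↦ 1` if `j = τ i`, and `0`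
otherwise. -/
def modeForm : LinearMap.BilinForm ℂ (ι →₀ ℂ) :=
  Finsupp.linearCombination ℂ (fun i : ι => Finsupp.lapply (τ i))

/-- The quadratic form whose Clifford algebra has the relations `{e_i, e_j} = δ_{j, τ i}` (for an
involution `τ`). -/
def modeQuad : QuadraticForm ℂ (ι →₀ ℂ) :=
  LinearMap.BilinMap.toQuadraticMap ((2⁻¹ : ℂ) • modeForm τ)

/-- The Clifford algebra with generators `e_i` and relations `{e_i, e_j} = δ_{j, τ i} 1`. -/
abbrev ModeClifford : Type := CliffordAlgebra (modeQuad τ)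

/-- The generator `e_i`. -/
def cliffMode (i : ι) : ModeClifford τ := CliffordAlgebra.ι (modeQuad τ) (Finsupp.single i 1)

open scoped Classical in
theorem cliffMode_anticomm (hτ : Function.Involutive τ) (i j : ι) :
    cliffMode τ i * cliffMode τ j + cliffMode τ j * cliffMode τ i =
      if j = τ i then 1 else 0 := by
  unfold cliffMode
  rw [CliffordAlgebra.ι_mul_ι_add_swap]
  have h1 : QuadraticMap.polar (modeQuad τ) (Finsupp.single i 1) (Finsupp.single j 1) =
      if j = τ i then 1 else 0 := by
    have hij : (i = τ j) ↔ (j = τ i) :=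
      ⟨fun h => by rw [h, hτ j], fun h => by rw [h, hτ i]⟩
    rw [modeQuad, LinearMap.BilinMap.polar_toQuadraticMap]
    simp only [modeForm, LinearMap.smul_apply, Finsupp.linearCombination_single, one_smul,
      Finsupp.lapply_apply, Finsupp.single_apply, hij, smul_eq_mul]
    split_ifs <;> norm_num
  rw [h1]
  split_ifs <;> simp

/-- The Fock space (highest weight module) of the Clifford algebra: the cyclic left module on a
vacuum vector subject to `e_i |0⟩ = 0` for `i ∈ ann`. -/
def Fock (ann : Set ι) : Type :=
  ModeClifford τ ⧸ Submodule.span (ModeClifford τ) (cliffMode τ '' ann)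

variable (ann : Set ι)

instance : AddCommGroup (Fock τ ann) := inferInstanceAs (AddCommGroup (_ ⧸ _))
instance : Module (ModeClifford τ) (Fock τ ann) :=
  inferInstanceAs (Module (ModeClifford τ) (_ ⧸ _))
instance : Module ℂ (Fock τ ann) := Module.compHom _ (algebraMap ℂ (ModeClifford τ))
instance : IsScalarTower ℂ (ModeClifford τ) (Fock τ ann) :=
  IsScalarTower.of_algebraMap_smul fun _ _ => rfl

/-- The projection `x ↦ x |0⟩`. -/
def Fock.proj : ModeClifford τ →ₗ[ModeClifford τ] Fock τ ann :=
  (Submodule.span (ModeClifford τ) (cliffMode τ '' ann)).mkQ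

/-- The vacuum vector. -/
def vacuum : Fock τ ann := Fock.proj τ ann 1

theorem smul_vacuum (x : ModeClifford τ) : x • vacuum τ ann = Fock.proj τ ann x := by
  rw [vacuum, ← map_smul, smul_eq_mul, mul_one]

/-- The operator by which the generator `e_i` acts on the Fock space. -/
def fockOp (i : ι) : Module.End ℂ (Fock τ ann) :=
  Algebra.lsmul ℂ ℂ (Fock τ ann) (cliffMode τ i)

theorem fockOp_vacuum {i : ι} (hi : i ∈ ann) : fockOp τ ann i (vacuum τ ann) = 0 := by
  change cliffMode τ i • vacuum τ ann = 0
  rw [smul_vacuum]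
  exact (Submodule.Quotient.mk_eq_zero _).2 (Submodule.subset_span ⟨i, hi, rfl⟩)

theorem fockOp_finite (hτ : Function.Involutive τ) (v : Fock τ ann) :
    {i | i ∈ ann ∧ fockOp τ ann i v ≠ 0}.Finite := by
  let G : Submodule ℂ (Fock τ ann) :=
    { carrier := {v | {i | i ∈ ann ∧ fockOp τ ann i v ≠ 0}.Finite}
      zero_mem' := by simp
      add_mem' := by
        intro v w hv hw
        refine (Set.Finite.union hv hw).subset fun i hi => ?_
        by_contra hn
        simp only [Set.mem_union, Set.mem_ofPred_eq, not_or, not_and, not_not] at hn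
        exact hi.2 (by rw [map_add, hn.1 hi.1, hn.2 hi.1, add_zero])
      smul_mem' := by
        intro t v hv
        refine Set.Finite.subset hv fun i hi => ⟨hi.1, fun h0 => hi.2 ?_⟩
        rw [map_smul, h0, smul_zero] }
  have hmode : ∀ (k : ι) (w : Fock τ ann), w ∈ G → cliffMode τ k • w ∈ G := by
    intro k w hw
    refine (Set.Finite.union hw (Set.finite_singleton (τ k))).subset fun i hi => ?_
    by_contra hn
    simp only [Set.mem_union, Set.mem_ofPred_eq, not_or, not_and, not_not,
      Set.mem_singleton_iff] at hn
    apply hi.2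
    have h1 := cliffMode_anticomm τ hτ i k
    have hk : ¬ (k = τ i) := fun h => hn.2 (by rw [h, hτ i])
    rw [if_neg hk] at h1
    have h2 : cliffMode τ i • w = 0 := hn.1 hi.1
    change cliffMode τ i • (cliffMode τ k • w) = 0
    rw [smul_smul, eq_neg_of_add_eq_zero_left h1, neg_smul, mul_smul, h2, smul_zero, neg_zero]
  have hgen : ∀ (f : ι →₀ ℂ) (w : Fock τ ann), w ∈ G →
      CliffordAlgebra.ι (modeQuad τ) f • w ∈ G := by
    intro f w hw
    induction f using Finsupp.induction_linear with
    | zero => simp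
    | add f₁ f₂ h₁ h₂ => rw [map_add, add_smul]; exact G.add_mem h₁ h₂
    | single i a =>
      have : (Finsupp.single i a : ι →₀ ℂ) = a • Finsupp.single i 1 := by simp
      rw [this, map_smul, smul_assoc]
      exact G.smul_mem a (hmode i w hw)
  have hall : ∀ (x : ModeClifford τ) (w : Fock τ ann), w ∈ G → x • w ∈ G := by
    intro x
    induction x using CliffordAlgebra.induction with
    | algebraMap r => intro w hw; rw [algebraMap_smul]; exact G.smul_mem r hw
    | ι f => exact hgen f
    | mul a b ha hb => intro w hw; rw [mul_smul]; exact ha _ (hb _ hw)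
    | add a b ha hb => intro w hw; rw [add_smul]; exact G.add_mem (ha _ hw) (hb _ hw)
  have hvac : vacuum τ ann ∈ G := by
    change {i | i ∈ ann ∧ fockOp τ ann i (vacuum τ ann) ≠ 0}.Finite
    convert Set.finite_empty
    ext i
    simp only [Set.mem_ofPred_eq, Set.mem_empty_iff_false, iff_false, not_and, not_not]
    exact fockOp_vacuum τ ann
  obtain ⟨x, rfl⟩ : ∃ x, Fock.proj τ ann x = v := Submodule.Quotient.mk_surjective _ v
  have hx := hall x _ hvac
  rw [smul_vacuum] at hx
  exact hx

end Clifford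

/-! ### The neutral fermion Fock space -/

/-- Index `j` stands for the mode `φ_{j+1/2}`, the coefficient of `z^{-j-1}` in `φ(z)`, so that
`{φ_{j+1/2}, φ_{k+1/2}} = 1` if `k = -1 - j`, and `0` otherwise. -/
def conjD (j : ℤ) : ℤ := -1 - j

theorem conjD_invol : Function.Involutive conjD := fun j => by unfold conjD; omega

/-- The Fock space `F^{⊗1/2}`: `φ_{j+1/2} |0⟩ = 0` for `j ≥ 0`. -/
abbrev FockD : Type := Fock conjD {j | 0 ≤ j}

/-- The neutral fermion field `φ(z)`. -/
def phiD : QField FockD where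
  mode j := fockOp conjD {j | 0 ≤ j} j
  truncated v := by
    obtain ⟨B, hB⟩ := (fockOp_finite conjD {j | 0 ≤ j} conjD_invol v).bddAbove
    refine ⟨max 0 (B + 1), fun n hn => ?_⟩
    by_contra h
    have : n ≤ B := hB ⟨by simp only [Set.mem_ofPred_eq]; omega, h⟩
    omega

/-- The modes of `h(z) = (1/2) :φ(z)φ(-z): = ∑ h_n z^{-2n-1}`. -/
def hD (n : ℤ) : Module.End ℂ FockD :=
  (2⁻¹ : ℂ) • QField.normalProductMode phiD phiD.reflect (2 * n)

/-- `φ_{-n_k-1/2} ⋯ φ_{-n_1-1/2} |0⟩` for the list `[n_k, …, n_1]`. -/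
def monomialD (l : List ℕ) : FockD :=
  l.foldr (fun n v => phiD.mode (-(n : ℤ) - 1) v) (vacuum conjD {j | 0 ≤ j})

/-- The number of odd entries minus the number of even entries. -/
def dg (l : List ℕ) : ℤ := (l.countP (fun n => n % 2 = 1) : ℤ) - l.countP (fun n => n % 2 = 0)

/-- The component `F_(m)` of degree `m` for the grading `dg`: the span of the basis monomials
(`n_k > ⋯ > n_1 ≥ 0`) of degree `m`. -/
def dgComponent (m : ℤ) : Submodule ℂ FockD :=
  Submodule.span ℂ {v | ∃ l : List ℕ, l.Pairwise (· > ·) ∧ dg l = m ∧ v = monomialD l}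

/-- The vectors `v_m`: for `n ≥ 0`, `v_n = φ_{-(2n-1)-1/2} ⋯ φ_{-3-1/2} φ_{-1-1/2} |0⟩` and
`v_{-n} = φ_{-(2n-2)-1/2} ⋯ φ_{-2-1/2} φ_{-1/2} |0⟩`. -/
def topVector : ℤ → FockD
  | Int.ofNat n => monomialD ((List.range n).map fun i => 2 * i + 1).reverse
  | Int.negSucc n => monomialD ((List.range (n + 1)).map fun i => 2 * i).reverse

/-! ### The charged fermion Fock space -/

/-- Indices `(true, n)` and `(false, n)` stand for the modes `ψ⁺_n` and `ψ⁻_n`, so that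
`{ψ⁺_m, ψ⁻_n} = δ_{m+n,-1}` and all other anticommutators vanish. -/
def conjA (i : Bool × ℤ) : Bool × ℤ := (!i.1, -1 - i.2)

theorem conjA_invol : Function.Involutive conjA := fun i => by
  refine Prod.ext (by simp [conjA]) ?_
  simp only [conjA]; omega

/-- The Fock space `F^{⊗1}`: `ψ⁺_n |0⟩ = ψ⁻_n |0⟩ = 0` for `n ≥ 0`. -/
abbrev FockA : Type := Fock conjA {i | 0 ≤ i.2}

/-- The charged fermion fields `ψ⁺(z)` (for `true`) and `ψ⁻(z)` (for `false`). -/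
def psiA (s : Bool) : QField FockA where
  mode n := fockOp conjA {i | 0 ≤ i.2} (s, n)
  truncated v := by
    obtain ⟨B, hB⟩ :=
      ((fockOp_finite conjA {i | 0 ≤ i.2} conjA_invol v).image Prod.snd).bddAbove
    refine ⟨max 0 (B + 1), fun n hn => ?_⟩
    by_contra h
    have : n ≤ B := hB ⟨(s, n), ⟨by simp only [Set.mem_ofPred_eq]; omega, h⟩, rfl⟩
    omega

/-- The modes of `h(z) = :ψ⁺(z)ψ⁻(z): = ∑ h_n z^{-n-1}`. -/
def hA (n : ℤ) : Module.End ℂ FockA := QField.normalProductMode (psiA true) (psiA false) n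

end

/-! The even and odd modes of the neutral fermion, `p_n = φ_{2n+1/2}` and `q_n = φ_{2n+3/2}`,
satisfy the relations of a pair of charged fermions, and the vacuum is cyclic for them. In
`(1/2):φ(z)φ(-z):` the sign from `-z` makes the terms with even and with odd first index contribute
equally, so `h^D` is exactly the current `:p(z)q(z):` (`hD_eq_current`). Both Fock spaces are
therefore instances of one structure, `ChargedFermions`, and everything reduces to the boson-fermion
correspondence for it.

That correspondence rests on four facts. The current satisfies the Heisenberg relations, the central
term being the boundary contribution of a telescoping sum (`current_rel`). For each charge `m` there
is a non-zero singular vector of weight `m`, and since `B_m` is irreducible, the map `B_m → V`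
sending `1` to that vector is injective; its image is the sector of charge `m`. The sectors together
are stable under all `p_j` and `q_j`, hence span `V` by cyclicity: the identity `∂p = :hp:` on a
charged vacuum expresses `p_j v_m` through negative Heisenberg modes applied to `v_{m+1}`
(`smul_p_chargedVac`, `p_chargedVac_mem_sector`). Finally, sector `m` lies in the `m`-eigenspace of
`h_0`, so the sum is direct and each sector is the whole eigenspace.

The fermionic monomials also span and are `h_0`-eigenvectors of eigenvalue `dg`, so `F_(m)` is the
same eigenspace (`dgComponent_eq_sector`); linear independence of the monomials is never needed.
Non-vanishing of the vacuum comes from the action of the Clifford algebra on an exterior algebra.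
The isomorphism of the two Fock spaces follows because both are `⨁ B_m`. -/

noncomputable section

open Filter

/-! ### Modes of normal ordered products -/

namespace QField

variable {V : Type*} [AddCommGroup V] [Module ℂ V]

theorem normalProductMode_apply (a b : QField V) (N : ℤ) (v : V) :
    normalProductMode a b N v = ∑ᶠ p : ℤ, normalOrder a b p (N - 1 - p) v := rfl

theorem eventually_mode_eq_zero (a : QField V) (v : V) : ∀ᶠ n : ℤ in atTop, a.mode n v = 0 := by
  obtain ⟨N, hN⟩ := a.truncated v
  filter_upwards [eventually_ge_atTop N] with n hn using hN n hn

/-- Because the window works for every large `L`, several such expansions, on different vectors, can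
be compared over one common finite window. -/
theorem eventually_normalProductMode_eq_sum (a b : QField V) (N : ℤ) (v : V) :
    ∀ᶠ L : ℤ in atTop, normalProductMode a b N v =
      ∑ p ∈ Finset.Ico (-L) L, normalOrder a b p (N - 1 - p) v := by
  have hfin := normalOrder_finite a b N v
  obtain ⟨B, hB⟩ := hfin.bddAbove
  obtain ⟨A, hA⟩ := hfin.bddBelow
  filter_upwards [eventually_ge_atTop (-A), eventually_gt_atTop B] with L h₁ h₂
  refine finsum_eq_sum_of_support_subset _ fun p hp => ?_
  have hpA : A ≤ p := hA hp
  have hpB : p ≤ B := hB hp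
  simp only [Finset.coe_Ico, Set.mem_Ico]
  omega

/-- If exactly one of `p`, `q` is negative, both sides involve literally the same product. Otherwise
`p + q ≠ -1`, and the modes anticommute; so the central term never intervenes. -/
theorem normalOrder_swap {a b : QField V} {p q : ℤ}
    (h : p + q ≠ -1 → a.mode p * b.mode q + b.mode q * a.mode p = 0) :
    normalOrder b a q p = -normalOrder a b p q := by
  unfold normalOrder
  split_ifs with h₁ h₂ h₂
  · exact eq_neg_of_add_eq_zero_right (h (by omega))
  · simp
  · simp
  · have := h (by omega)
    rw [neg_neg]
    exact (eq_neg_of_add_eq_zero_right this).symm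

/-- Normal ordered products of odd fields that anticommute up to a central term are
antisymmetric. -/
theorem normalProductMode_swap {a b : QField V}
    (h : ∀ p q, p + q ≠ -1 → a.mode p * b.mode q + b.mode q * a.mode p = 0) (N : ℤ) :
    normalProductMode b a N = -normalProductMode a b N := by
  ext v
  rw [LinearMap.neg_apply, normalProductMode_apply, normalProductMode_apply, ← finsum_neg_distrib,
    ← finsum_comp_equiv (Equiv.subLeft (N - 1))]
  refine finsum_congr fun p => ?_
  rw [Equiv.subLeft_apply, sub_sub_cancel, normalOrder_swap (h _ _), LinearMap.neg_apply]

end QField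

/-! ### Charged fermions and the Heisenberg relations of their current -/

/-- A pair of charged fermion fields acting on `V`, with a cyclic vacuum vector. -/
structure ChargedFermions (V : Type*) [AddCommGroup V] [Module ℂ V] where
  p : QField V
  q : QField V
  p_p : ∀ a b, p.mode a * p.mode b + p.mode b * p.mode a = 0
  q_q : ∀ a b, q.mode a * q.mode b + q.mode b * q.mode a = 0
  p_q : ∀ a b, p.mode a * q.mode b + q.mode b * p.mode a = if a + b = -1 then 1 else 0
  vac : V
  p_vac : ∀ n : ℤ, 0 ≤ n → p.mode n vac = 0
  q_vac : ∀ n : ℤ, 0 ≤ n → q.mode n vac = 0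
  vac_ne_zero : vac ≠ 0
  cyclic : ∀ S : Submodule ℂ V, vac ∈ S →
    (∀ n, ∀ v ∈ S, p.mode n v ∈ S ∧ q.mode n v ∈ S) → S = ⊤

/-- Telescoping: a shift by `m` moves `m` values equal to `c` in at the top and `m` zeros out at the
bottom. This is where the factor `m` of the central term originates. -/
theorem sum_Ico_shift_sub {V : Type*} [AddCommGroup V] [Module ℂ V] (f : ℤ → V) (c : V)
    (L m : ℤ) (hlow : ∀ a < |m| - L, f a = 0) (hhigh : ∀ a, L - |m| ≤ a → f a = c) (hL : |m| ≤ L) :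
    ∑ a ∈ Finset.Ico (-L) L, (f (m + a) - f a) = (m : ℂ) • c := by
  have key : ∀ (k : ℕ) (g : ℤ → V), (∀ a < k - L, g a = 0) → (∀ a, L ≤ a → g a = c) →
      ∑ a ∈ Finset.Ico (-L) L, (g (k + a) - g a) = (k : ℂ) • c := by
    intro k g h₁ h₂
    induction k with
    | zero => simp
    | succ k ih =>
      have tele : ∀ n : ℕ, ∑ a ∈ Finset.Ico (-L) (-L + n), (g (k + 1 + a) - g (k + a)) =
          g (k + (-L + n)) - g (k - L) := by
        intro n
        induction n with
        | zero => simp [sub_eq_add_neg]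
        | succ n ihn =>
          rw [show (-L + ((n + 1 : ℕ) : ℤ)) = (-L + n) + 1 by push_cast; ring,
            ← Finset.insert_Ico_right_eq_Ico_add_one (by omega), Finset.sum_insert (by simp), ihn]
          rw [show (k : ℤ) + 1 + (-L + n) = k + (-L + n + 1) by ring]
          abel
      have t := tele (2 * L).toNat
      rw [show (-L + ((2 * L).toNat : ℤ)) = L by have := abs_nonneg m; omega,
        h₂ _ (by omega), h₁ _ (by push_cast; omega), sub_zero] at t
      have ih' := ih (fun a ha => h₁ a (by push_cast; omega))
      rw [show ((k + 1 : ℕ) : ℂ) • c = c + (k : ℂ) • c by push_cast; rw [add_smul, one_smul, add_comm],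
        ← ih', ← t, ← Finset.sum_add_distrib]
      exact Finset.sum_congr rfl fun a _ => by push_cast; abel
  rcases le_total 0 m with hm | hm
  · rw [abs_of_nonneg hm] at *
    have := key m.toNat f (fun a ha => hlow a (by omega)) (fun a ha => hhigh a (by omega))
    rw [← Int.cast_natCast (R := ℂ), Int.toNat_of_nonneg hm] at this
    exact this
  -- A negative shift of `f` is the positive shift by `-m` of `a ↦ f (m + a)`, with the sign
  -- reversed.
  · rw [abs_of_nonpos hm] at *
    have := key (-m).toNat (fun a => f (m + a)) (fun a ha => hlow _ (by omega))
      (fun a ha => hhigh _ (by omega))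
    rw [← Int.cast_natCast (R := ℂ), Int.toNat_of_nonneg (by omega)] at this
    rw [← neg_inj, ← Finset.sum_neg_distrib, ← neg_smul, ← Int.cast_neg, ← this]
    exact Finset.sum_congr rfl fun a _ => by rw [neg_sub]; congr 2; ring

namespace ChargedFermions

variable {V : Type*} [AddCommGroup V] [Module ℂ V] (C : ChargedFermions V)

/-- The charge conjugate pair of fields. -/
def conj : ChargedFermions V where
  p := C.q
  q := C.p
  p_p := C.q_q
  q_q := C.p_p
  p_q a b := by rw [add_comm, C.p_q, add_comm b a]
  vac := C.vac
  p_vac := C.q_vac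
  q_vac := C.p_vac
  vac_ne_zero := C.vac_ne_zero
  cyclic S h₀ h := C.cyclic S h₀ fun n v hv => (h n v hv).symm

/-- The modes of the current `:p(z)q(z):`. -/
def current (n : ℤ) : Module.End ℂ V := QField.normalProductMode C.p C.q n

theorem p_q_of_ne {a b : ℤ} (h : a + b ≠ -1) :
    C.p.mode a * C.q.mode b + C.q.mode b * C.p.mode a = 0 := by
  rw [C.p_q, if_neg h]

theorem conj_current (n : ℤ) : C.conj.current n = -C.current n :=
  QField.normalProductMode_swap (fun _ _ => C.p_q_of_ne) n

/-- The two orderings of `p_a` and `q_b` differ by a sign and a scalar, so the sign of `a` does not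
affect the commutator. -/
theorem normalOrder_comm_p (a b k : ℤ) :
    QField.normalOrder C.p C.q a b * C.p.mode k - C.p.mode k * QField.normalOrder C.p C.q a b =
      if k + b = -1 then C.p.mode a else 0 := by
  unfold QField.normalOrder
  rcases lt_or_ge a 0 with h | h
  · rw [if_pos h]
    trans C.p.mode a * (C.p.mode k * C.q.mode b + C.q.mode b * C.p.mode k) -
      (C.p.mode a * C.p.mode k + C.p.mode k * C.p.mode a) * C.q.mode b
    · noncomm_ring
    · rw [C.p_q, C.p_p]; split_ifs <;> simp
  · rw [if_neg h.not_gt]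
    trans (C.p.mode k * C.q.mode b + C.q.mode b * C.p.mode k) * C.p.mode a -
      C.q.mode b * (C.p.mode a * C.p.mode k + C.p.mode k * C.p.mode a)
    · noncomm_ring
    · rw [C.p_q, C.p_p]; split_ifs <;> simp

theorem current_comm_p (n k : ℤ) :
    C.current n * C.p.mode k - C.p.mode k * C.current n = C.p.mode (n + k) := by
  ext v
  -- The commutator with the summand of index `a` survives only for `a = n + k`, so the window has
  -- to contain that index.
  obtain ⟨L, h₁, h₂, h₃, h₄⟩ :=
    ((QField.eventually_normalProductMode_eq_sum C.p C.q n v).and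
      ((QField.eventually_normalProductMode_eq_sum C.p C.q n (C.p.mode k v)).and
        ((eventually_gt_atTop (n + k)).and (eventually_ge_atTop (-(n + k)))))).exists
  have h (a : ℤ) := LinearMap.congr_fun (C.normalOrder_comm_p a (n - 1 - a) k) v
  simp only [LinearMap.sub_apply, Module.End.mul_apply] at h ⊢
  rw [current, h₁, h₂, map_sum, ← Finset.sum_sub_distrib, Finset.sum_congr rfl fun a _ => h a,
    Finset.sum_eq_single (n + k)]
  · rw [if_pos (by omega)]
  · intro a _ ha
    rw [if_neg (by omega), LinearMap.zero_apply]
  · intro h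
    exact absurd (Finset.mem_Ico.2 ⟨by omega, h₃⟩) h

theorem current_comm_q (n k : ℤ) :
    C.current n * C.q.mode k - C.q.mode k * C.current n = -C.q.mode (n + k) := by
  have h := C.conj.current_comm_p n k
  rw [conj_current] at h
  change _ = C.q.mode (n + k) at h
  rw [← h]
  change _ = -(-C.current n * C.q.mode k - C.q.mode k * -C.current n)
  noncomm_ring

theorem current_p_apply (n k : ℤ) (v : V) :
    C.current n (C.p.mode k v) = C.p.mode k (C.current n v) + C.p.mode (n + k) v := by
  rw [← sub_eq_iff_eq_add']
  exact LinearMap.congr_fun (C.current_comm_p n k) v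

theorem current_q_apply (n k : ℤ) (v : V) :
    C.current n (C.q.mode k v) = C.q.mode k (C.current n v) - C.q.mode (n + k) v := by
  rw [sub_eq_add_neg, ← sub_eq_iff_eq_add']
  exact LinearMap.congr_fun (C.current_comm_q n k) v

theorem p_q_apply (a b : ℤ) (v : V) :
    C.p.mode a (C.q.mode b v) = (if a + b = -1 then v else 0) - C.q.mode b (C.p.mode a v) := by
  rw [eq_sub_iff_add_eq]
  have := LinearMap.congr_fun (C.p_q a b) v
  split_ifs at this ⊢ <;> exact this

theorem p_p_apply (a b : ℤ) (v : V) :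
    C.p.mode a (C.p.mode b v) = -C.p.mode b (C.p.mode a v) :=
  eq_neg_of_add_eq_zero_left (LinearMap.congr_fun (C.p_p a b) v)

/-- The right side needs no normal ordering: its two products have the same index sum `m + a + b`,
so the scalars produced by reordering cancel. -/
theorem current_normalOrder_apply (m a b : ℤ) (v : V) :
    C.current m (QField.normalOrder C.p C.q a b v) - QField.normalOrder C.p C.q a b (C.current m v) =
      C.p.mode (m + a) (C.q.mode b v) - C.p.mode a (C.q.mode (m + b) v) := by
  unfold QField.normalOrder
  split_ifs with h
  · simp only [Module.End.mul_apply, current_p_apply, current_q_apply, map_sub]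
    abel
  · simp only [Module.End.mul_apply, LinearMap.neg_apply, map_neg, current_p_apply,
      current_q_apply, map_add, p_q_apply]
    rw [show m + a + b = a + (m + b) by ring]
    abel

theorem current_rel : HeisRel C.current := by
  intro m n
  ext v
  -- Besides capturing both sums, `L` is so large that `p_a v = 0` for `a ≥ L - |m|` and
  -- `q_{n+m-1-a} v = 0` for `a < |m| - L`.
  obtain ⟨L, h₁, h₂, h₃, hp, hq, h₅⟩ :=
    ((QField.eventually_normalProductMode_eq_sum C.p C.q n v).and
      ((QField.eventually_normalProductMode_eq_sum C.p C.q n (C.current m v)).and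
        ((eventually_ge_atTop |m|).and
        ((tendsto_atTop_add_const_right atTop (-|m|) tendsto_id).eventually_forall_ge_atTop
            (C.p.eventually_mode_eq_zero v) |>.and
        (((tendsto_atTop_add_const_right atTop (n + m - 1 - |m|) tendsto_id).eventually_forall_ge_atTop
            (C.q.eventually_mode_eq_zero v)).and (eventually_ge_atTop (0 : ℤ))))))).exists
  simp only [id] at hp hq
  rw [LinearMap.sub_apply, Module.End.mul_apply, Module.End.mul_apply,
    show C.current n v = _ from h₁, show C.current n (C.current m v) = _ from h₂, map_sum,
    ← Finset.sum_sub_distrib]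
  -- At the low end `q` kills `v`. At the high end `p` does, leaving only the anticommutator, which
  -- is non-zero exactly when `m + n = 0`.
  have hs := sum_Ico_shift_sub (fun a => C.p.mode a (C.q.mode (n + m - 1 - a) v))
    (if m + n = 0 then v else 0) L m
    (fun a ha => by rw [hq _ (by omega), map_zero])
    (fun a ha => by
      rw [p_q_apply, hp a (by omega), map_zero, sub_zero]
      exact if_congr (by constructor <;> intro <;> omega) rfl rfl) h₃
  calc _ = _ := Finset.sum_congr rfl fun a _ => by
          rw [current_normalOrder_apply, show m + (n - 1 - a) = n + m - 1 - a by ring,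
            show n - 1 - a = n + m - 1 - (m + a) by ring]
    _ = _ := hs
    _ = _ := by split_ifs <;> simp

end ChargedFermions

theorem eq_zero_of_eq_neg_self {V : Type*} [AddCommGroup V] [Module ℂ V] {v : V} (h : v = -v) :
    v = 0 := by
  have h₂ : (2 : ℂ) • v = 0 := by
    rw [two_smul]
    exact eq_neg_iff_add_eq_zero.mp h
  exact (smul_eq_zero.mp h₂).resolve_left two_ne_zero

/-! ### Charged vacua -/

namespace ChargedFermions

variable {V : Type*} [AddCommGroup V] [Module ℂ V] (C : ChargedFermions V)

theorem p_p_self (a : ℤ) (v : V) : C.p.mode a (C.p.mode a v) = 0 :=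
  eq_zero_of_eq_neg_self (C.p_p_apply a a v)

theorem q_p_apply (a b : ℤ) (v : V) :
    C.q.mode a (C.p.mode b v) = (if a + b = -1 then v else 0) - C.p.mode b (C.q.mode a v) :=
  C.conj.p_q_apply a b v

theorem current_vac (n : ℤ) (hn : 0 ≤ n) : C.current n C.vac = 0 := by
  refine finsum_eq_zero_of_forall_eq_zero fun a => ?_
  unfold QField.normalOrder
  split_ifs with h
  · rw [Module.End.mul_apply, C.q_vac _ (by omega), map_zero]
  · rw [LinearMap.neg_apply, Module.End.mul_apply, C.p_vac _ (by omega), map_zero, neg_zero]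

/-- The vectors `p_{-n} ⋯ p_{-1} |0⟩`. -/
def posVac : ℕ → V
  | 0 => C.vac
  | n + 1 => C.p.mode (-(n : ℤ) - 1) (posVac n)

theorem p_posVac (n : ℕ) : ∀ j : ℤ, -n ≤ j → C.p.mode j (C.posVac n) = 0 := by
  induction n with
  | zero => exact fun j hj => C.p_vac j (by simpa using hj)
  | succ n ih =>
    intro j hj
    rw [posVac]
    rcases eq_or_ne j (-(n : ℤ) - 1) with rfl | h
    · exact C.p_p_self _ _
    · rw [p_p_apply, ih j (by push_cast at hj; omega), map_zero, neg_zero]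

theorem q_posVac (n : ℕ) : ∀ j : ℤ, n ≤ j → C.q.mode j (C.posVac n) = 0 := by
  induction n with
  | zero => exact fun j hj => C.q_vac j (by simpa using hj)
  | succ n ih =>
    intro j hj
    push_cast at hj
    rw [posVac, q_p_apply, if_neg (by omega), ih j (by omega), map_zero, sub_zero]

/-- Removing the last creation operator recovers the previous vector; hence no `posVac n` vanishes.
-/
theorem q_posVac_succ (n : ℕ) : C.q.mode n (C.posVac (n + 1)) = C.posVac n := by
  rw [posVac, q_p_apply, if_pos (by omega), C.q_posVac n n le_rfl, map_zero, sub_zero]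

theorem posVac_ne_zero (n : ℕ) : C.posVac n ≠ 0 := by
  induction n with
  | zero => exact C.vac_ne_zero
  | succ n ih =>
    intro h
    rw [← q_posVac_succ, h, map_zero] at ih
    exact ih rfl

theorem current_posVac (n : ℕ) (k : ℤ) (hk : 0 ≤ k) :
    C.current k (C.posVac n) = (if k = 0 then (n : ℂ) else 0) • C.posVac n := by
  induction n with
  | zero => rw [posVac, C.current_vac k hk]; simp
  | succ n ih =>
    rw [posVac, current_p_apply, ih]
    split_ifs with h
    · subst h
      rw [map_smul, zero_add]
      push_cast
      rw [add_smul, one_smul]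
    · rw [C.p_posVac n _ (by omega), zero_smul, zero_smul, map_zero, zero_add]

/-- The vacuum vector of charge `m`. -/
def chargedVac : ℤ → V
  | Int.ofNat n => C.posVac n
  | Int.negSucc n => C.conj.posVac (n + 1)

theorem chargedVac_natCast (n : ℕ) : C.chargedVac n = C.posVac n := rfl

theorem chargedVac_neg_natCast (n : ℕ) : C.chargedVac (-n) = C.conj.posVac n := by
  cases n with
  | zero => rfl
  | succ n => rfl

theorem conj_chargedVac (m : ℤ) : C.conj.chargedVac m = C.chargedVac (-m) := by
  obtain ⟨n, rfl | rfl⟩ := m.eq_nat_or_neg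
  · rw [chargedVac_neg_natCast, chargedVac_natCast]
  · rw [chargedVac_neg_natCast, neg_neg, chargedVac_natCast]
    rfl

theorem chargedVac_ne_zero (m : ℤ) : C.chargedVac m ≠ 0 := by
  obtain ⟨n, rfl | rfl⟩ := m.eq_nat_or_neg
  · exact C.posVac_ne_zero n
  · rw [chargedVac_neg_natCast]
    exact C.conj.posVac_ne_zero n

theorem p_chargedVac_of_ge (m j : ℤ) (h : -m ≤ j) : C.p.mode j (C.chargedVac m) = 0 := by
  obtain ⟨n, rfl | rfl⟩ := m.eq_nat_or_neg
  · exact C.p_posVac n j h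
  · rw [chargedVac_neg_natCast]
    exact C.conj.q_posVac n j (by omega)

theorem q_chargedVac_of_ge (m j : ℤ) (h : m ≤ j) : C.q.mode j (C.chargedVac m) = 0 := by
  have := C.conj.p_chargedVac_of_ge (-m) j (by omega)
  rwa [conj_chargedVac, neg_neg] at this

/-- For `m ≥ 0` a new `p` mode is added; for `m < 0` the outermost `q` mode is removed instead. -/
theorem p_chargedVac (m : ℤ) : C.p.mode (-m - 1) (C.chargedVac m) = C.chargedVac (m + 1) := by
  rcases le_or_gt 0 m with h | h
  · obtain ⟨n, rfl⟩ := Int.eq_ofNat_of_zero_le h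
    rfl
  · obtain ⟨n, hn⟩ := Int.eq_ofNat_of_zero_le (show 0 ≤ -m - 1 by omega)
    rw [hn, show m = -((n + 1 : ℕ) : ℤ) by push_cast; omega, chargedVac_neg_natCast,
      show -((n + 1 : ℕ) : ℤ) + 1 = -(n : ℤ) by push_cast; omega, chargedVac_neg_natCast]
    exact C.conj.q_posVac_succ n

theorem current_chargedVac (m k : ℤ) (hk : 0 ≤ k) :
    C.current k (C.chargedVac m) = (if k = 0 then (m : ℂ) else 0) • C.chargedVac m := by
  obtain ⟨n, rfl | rfl⟩ := m.eq_nat_or_neg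
  · exact C.current_posVac n k hk
  · have := C.conj.current_posVac n k hk
    rw [conj_current, LinearMap.neg_apply, neg_eq_iff_eq_neg] at this
    rw [chargedVac_neg_natCast, this, ← neg_smul]
    split_ifs <;> simp

/-- Expanding the current turns the sum into a double sum of `p_i p_a q_{j-1-i-a} v_m` over one
square of indices `i`, `a`. It is antisymmetric in `i` and `a`, hence zero. -/
theorem sum_p_current_chargedVac (m : ℤ) (k : ℕ) :
    ∑ i ∈ Finset.Ico (-m - k) (-m),
      C.p.mode i (C.current (-m - 1 - k - i) (C.chargedVac m)) = 0 := by
  set j : ℤ := -m - 1 - k with hj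
  set s := Finset.Ico (-m - (k : ℤ)) (-m) with hs
  have hmem {i : ℤ} : i ∈ s ↔ j < i ∧ i < -m := by rw [hs, Finset.mem_Ico]; omega
  let T (i a : ℤ) : V := C.p.mode i (C.p.mode a (C.q.mode (j - 1 - i - a) (C.chargedVac m)))
  -- For `a ≥ -m` the mode `p_a` annihilates the charged vacuum, and for `a ≤ j` the `q` mode does.
  -- Since `j - i ≠ 0`, the two modes anticommute and normal ordering plays no role.
  have hT (i : ℤ) (hi : i ∈ s) :
      C.p.mode i (C.current (j - i) (C.chargedVac m)) = ∑ a ∈ s, T i a := by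
    rw [hmem] at hi
    obtain ⟨L, h₁, h₂, h₃⟩ :=
      ((QField.eventually_normalProductMode_eq_sum C.p C.q (j - i) (C.chargedVac m)).and
        ((eventually_ge_atTop (-m)).and (eventually_ge_atTop (-j)))).exists
    rw [current, h₁, map_sum]
    symm
    refine Finset.sum_subset_zero_on_sdiff ?_ ?_ ?_
    · intro a ha
      rw [hmem] at ha
      rw [Finset.mem_Ico]
      omega
    · intro a ha
      rw [Finset.mem_sdiff, hmem] at ha
      unfold QField.normalOrder
      split_ifs with ha0
      · rw [Module.End.mul_apply]
        by_cases hq : m ≤ j - i - 1 - a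
        · rw [C.q_chargedVac_of_ge m _ hq, map_zero, map_zero]
        · rw [p_q_apply, if_neg (by omega), C.p_chargedVac_of_ge m a (by omega), map_zero, sub_zero,
            map_zero]
      · rw [LinearMap.neg_apply, Module.End.mul_apply]
        by_cases hp : -m ≤ a
        · rw [C.p_chargedVac_of_ge m a hp, map_zero, neg_zero, map_zero]
        · rw [q_p_apply, if_neg (by omega), C.q_chargedVac_of_ge m _ (by omega), map_zero, sub_zero,
            neg_zero, map_zero]
    · intro a ha
      rw [hmem] at ha
      unfold QField.normalOrder
      simp only [T]
      split_ifs with ha0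
      · rw [Module.End.mul_apply, show j - i - 1 - a = j - 1 - i - a by ring]
      · rw [LinearMap.neg_apply, Module.End.mul_apply, q_p_apply, if_neg (by omega), zero_sub,
          neg_neg, show j - i - 1 - a = j - 1 - i - a by ring]
  rw [Finset.sum_congr rfl hT]
  refine eq_zero_of_eq_neg_self ?_
  conv_lhs => rw [Finset.sum_comm]
  rw [← Finset.sum_neg_distrib]
  refine Finset.sum_congr rfl fun a _ => ?_
  rw [← Finset.sum_neg_distrib]
  refine Finset.sum_congr rfl fun i _ => ?_
  simp only [T]
  rw [p_p_apply, show j - 1 - i - a = j - 1 - a - i by ring]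

/-- The action of `p(z)` on a charged vacuum satisfies `∂p(z) = :h(z)p(z):`. -/
theorem smul_p_chargedVac (m : ℤ) (k : ℕ) :
    (k : ℂ) • C.p.mode (-m - 1 - k) (C.chargedVac m) =
      ∑ i ∈ Finset.Ico (-m - k) (-m),
        C.current (-m - 1 - k - i) (C.p.mode i (C.chargedVac m)) := by
  -- Moving the current past `p_i` produces the same vector `p_{-m-1-k} v_m` for each of the `k`
  -- values of `i`; the remaining terms sum to zero by antisymmetry.
  have h : ∀ i ∈ Finset.Ico (-m - (k : ℤ)) (-m),
      C.current (-m - 1 - k - i) (C.p.mode i (C.chargedVac m)) =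
        C.p.mode i (C.current (-m - 1 - k - i) (C.chargedVac m)) +
          C.p.mode (-m - 1 - k) (C.chargedVac m) := by
    intro i _
    rw [current_p_apply, sub_add_cancel]
  rw [Finset.sum_congr rfl h, Finset.sum_add_distrib, sum_p_current_chargedVac, zero_add,
    Finset.sum_const, Int.card_Ico, ← Nat.cast_smul_eq_nsmul ℂ]
  congr 2
  omega

end ChargedFermions

/-! ### Highest weight vectors of the Heisenberg algebra -/

/-- Differentiating by a variable that occurs lowers the total degree and, in characteristic zero,
does not give zero; iterating ends at a non-zero constant. -/
theorem MvPolynomial.one_mem_of_pderiv_mem {σ k : Type*} [Field k] [CharZero k]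
    (K : Submodule k (MvPolynomial σ k)) (hK : ∀ i, ∀ p ∈ K, pderiv i p ∈ K)
    (p : MvPolynomial σ k) (hp : p ∈ K) (hp0 : p ≠ 0) : (1 : MvPolynomial σ k) ∈ K := by
  induction hn : p.totalDegree using Nat.strong_induction_on generalizing p with
  | _ n ih =>
    rcases Nat.eq_zero_or_pos n with rfl | hpos
    · classical
      rw [totalDegree_eq_zero_iff_eq_C] at hn
      have hc : coeff 0 p ≠ 0 := fun h => hp0 (by rw [hn, h, C_0])
      have := K.smul_mem (coeff 0 p)⁻¹ hp
      rw [hn, smul_eq_C_mul, coeff_C, if_pos rfl, ← C_mul, inv_mul_cancel₀ hc, C_1] at this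
      exact this
    · obtain ⟨d, hd, i, hi⟩ : ∃ d ∈ p.support, ∃ i, d i ≠ 0 := by
        by_contra! h
        have : p.totalDegree ≤ 0 := Finset.sup_le fun d hd => by
          rw [show d = 0 from Finsupp.ext (h d hd)]; simp
        omega
      have hle : Finsupp.single i 1 ≤ d := by
        rw [Finsupp.single_le_iff]; omega
      refine ih _ ?_ (pderiv i p) (hK i p hp) ?_ rfl
      · rw [← hn, totalDegree, Finset.sup_lt_iff (by rw [bot_eq_zero]; omega)]
        intro m hm
        have hm' : m + Finsupp.single i 1 ∈ p.support := by
          rw [mem_support_iff] at hm ⊢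
          rw [coeff_pderiv] at hm
          exact left_ne_zero_of_mul hm
        have := le_totalDegree hm'
        rw [Finsupp.sum_add_index' (fun _ => rfl) (fun _ _ _ => rfl),
          Finsupp.sum_single_index rfl] at this
        omega
      -- The coefficient of `∂_i p` at `d - e_i` is `d i` times that of `p` at `d`.
      · intro h0
        have := congrArg (coeff (d - Finsupp.single i 1)) h0
        rw [coeff_pderiv, tsub_add_cancel_of_le hle, coeff_zero, mul_eq_zero] at this
        rcases this with h | h
        · exact mem_support_iff.mp hd h
        · exact Nat.cast_add_one_ne_zero _ h

/-! ### Irreducibility of `B_λ` -/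

namespace BosonModule

variable {lam : ℂ}

theorem h_pos_lie (n : ℕ+) (x : MvPolynomial ℕ+ ℂ) :
    ⁅HeisZ.h (n : ℕ), HeisModule.of (bosonOp lam) (bosonOp_rel lam) x⁆ =
      HeisModule.of (bosonOp lam) (bosonOp_rel lam) (MvPolynomial.pderiv n x) := by
  obtain ⟨k, rfl⟩ : ∃ k : ℕ, k.succPNat = n := ⟨n.natPred, PNat.succPNat_natPred n⟩
  exact HeisModule.h_lie _ _ _ _

theorem h_neg_lie (n : ℕ+) (x : MvPolynomial ℕ+ ℂ) :
    ⁅HeisZ.h (-(n : ℕ)), HeisModule.of (bosonOp lam) (bosonOp_rel lam) x⁆ =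
      HeisModule.of (bosonOp lam) (bosonOp_rel lam) ((n : ℂ) • (MvPolynomial.X n * x)) := by
  obtain ⟨k, rfl⟩ : ∃ k : ℕ, k.succPNat = n := ⟨n.natPred, PNat.succPNat_natPred n⟩
  rw [show -(((k.succPNat : ℕ+) : ℕ) : ℤ) = Int.negSucc k from rfl, HeisModule.h_lie]
  simp [bosonOp]

theorem eq_top_of_one_mem (N : LieSubmodule ℂ HeisZ (BosonModule lam))
    (h : HeisModule.of (bosonOp lam) (bosonOp_rel lam) 1 ∈ N) : N = ⊤ := by
  rw [eq_top_iff]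
  have key : ∀ x : MvPolynomial ℕ+ ℂ, HeisModule.of (bosonOp lam) (bosonOp_rel lam) x ∈ N := by
    intro x
    induction x using MvPolynomial.induction_on with
    | C a =>
      rw [← mul_one (MvPolynomial.C a), ← MvPolynomial.smul_eq_C_mul, map_smul]
      exact N.smul_mem a h
    | add x y hx hy => rw [map_add]; exact add_mem hx hy
    | mul_X x n hx =>
      have := N.smul_mem (n : ℂ)⁻¹ (N.lie_mem (x := HeisZ.h (-(n : ℕ))) hx)
      rw [h_neg_lie, ← map_smul, inv_smul_smul₀ (Nat.cast_ne_zero.mpr n.ne_zero), mul_comm] at this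
      exact this
  exact fun x _ => key x

/-- Positive modes, being derivatives, descend from any non-zero polynomial to `1`; negative modes,
being multiplications by variables, climb from `1` to everything. -/
theorem eq_top_of_ne_bot (N : LieSubmodule ℂ HeisZ (BosonModule lam)) (h : N ≠ ⊥) : N = ⊤ := by
  obtain ⟨x, hx, hx0⟩ := N.toSubmodule.exists_mem_ne_zero_of_ne_bot (by simpa using h)
  refine eq_top_of_one_mem N ?_
  refine MvPolynomial.one_mem_of_pderiv_mem
    (N.toSubmodule.comap (HeisModule.of (bosonOp lam) (bosonOp_rel lam)).toLinearMap)
    (fun i p hp => ?_) x hx hx0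
  have := N.lie_mem (x := HeisZ.h (i : ℕ)) hp
  exact (h_pos_lie (lam := lam) i p) ▸ this

instance : Nontrivial (BosonModule lam) := inferInstanceAs (Nontrivial (MvPolynomial ℕ+ ℂ))

instance isIrreducible : LieModule.IsIrreducible ℂ HeisZ (BosonModule lam) :=
  LieModule.IsIrreducible.mk eq_top_of_ne_bot

theorem isHeisHighestWeightVector_one :
    IsHeisHighestWeightVector lam (HeisModule.of (bosonOp lam) (bosonOp_rel lam) 1) where
  ne_zero := one_ne_zero (α := MvPolynomial ℕ+ ℂ)
  annihilated n hn := by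
    obtain ⟨k, rfl⟩ := Int.eq_succ_of_zero_lt hn
    exact (h_pos_lie k.succPNat 1).trans (by simp)
  weight := by
    rw [HeisModule.h_lie]
    simp [show bosonOp lam 0 = lam • 1 from rfl]
  level := HeisModule.c_lie _ _ _
  generates := eq_top_of_one_mem _ (LieSubmodule.subset_lieSpan rfl)

end BosonModule

theorem IsHeisHighestWeightVector.map_equiv {M M' : Type*} [AddCommGroup M] [Module ℂ M]
    [LieRingModule HeisZ M] [LieModule ℂ HeisZ M] [AddCommGroup M'] [Module ℂ M']
    [LieRingModule HeisZ M'] [LieModule ℂ HeisZ M'] {lam : ℂ} {v : M}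
    (h : IsHeisHighestWeightVector lam v) (e : M ≃ₗ⁅ℂ,HeisZ⁆ M') :
    IsHeisHighestWeightVector lam (e v) where
  ne_zero h0 := h.ne_zero (e.injective (h0.trans (map_zero e.toLieModuleHom).symm))
  annihilated n hn :=
    (e.toLieModuleHom.map_lie _ _).symm.trans
      ((congrArg e (h.annihilated n hn)).trans (map_zero e.toLieModuleHom))
  weight := (e.toLieModuleHom.map_lie _ _).symm.trans
      ((congrArg e h.weight).trans (map_smul e.toLieModuleHom _ _))
  level := (e.toLieModuleHom.map_lie _ _).symm.trans (congrArg e h.level)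
  generates := by
    have h₁ : (LieSubmodule.lieSpan ℂ HeisZ {e v}).comap e.toLieModuleHom = ⊤ := by
      rw [eq_top_iff, ← h.generates, LieSubmodule.lieSpan_le, Set.singleton_subset_iff]
      exact LieSubmodule.subset_lieSpan (Set.mem_singleton (e v))
    rw [eq_top_iff]
    intro x _
    obtain ⟨y, rfl⟩ := e.surjective x
    exact (h₁ ▸ LieSubmodule.mem_top y :)

/-! ### Homomorphisms from `B_λ` defined by singular vectors -/

namespace HeisRel

variable {V : Type*} [AddCommGroup V] [Module ℂ V] {op : ℤ → Module.End ℂ V}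

theorem commute_neg (hop : HeisRel op) (m n : ℕ+) :
    Commute (op (-(m : ℕ))) (op (-(n : ℕ))) := by
  have := hop (-(m : ℕ)) (-(n : ℕ))
  rw [if_neg (by have := m.pos; have := n.pos; omega)] at this
  exact sub_eq_zero.mp this

open scoped IsMulCommutative in
/-- The algebra homomorphism with `x_n ↦ n⁻¹ h_{-n}`. -/
def creation (hop : HeisRel op) : MvPolynomial ℕ+ ℂ →ₐ[ℂ] Module.End ℂ V :=
  -- `MvPolynomial.aeval` needs a commutative target; the subalgebra generated by the commuting
  -- negative modes provides one.
  haveI : IsMulCommutative (Algebra.adjoin ℂ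
      (Set.range fun n : ℕ+ => (n : ℂ)⁻¹ • op (-(n : ℕ)))) :=
    Algebra.isMulCommutative_adjoin ℂ (by
      rintro _ ⟨m, rfl⟩ _ ⟨n, rfl⟩
      exact ((hop.commute_neg m n).smul_left _).smul_right _)
  (Algebra.adjoin ℂ (Set.range fun n : ℕ+ => (n : ℂ)⁻¹ • op (-(n : ℕ)))).val.comp
    (MvPolynomial.aeval fun n => ⟨_, Algebra.subset_adjoin ⟨n, rfl⟩⟩)

theorem creation_X (hop : HeisRel op) (n : ℕ+) :
    hop.creation (MvPolynomial.X n) = (n : ℂ)⁻¹ • op (-(n : ℕ)) := by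
  simp [creation]

theorem creation_X_mul_apply (hop : HeisRel op) (n : ℕ+) (x : MvPolynomial ℕ+ ℂ) (v : V) :
    hop.creation (MvPolynomial.X n * x) v = (n : ℂ)⁻¹ • op (-(n : ℕ)) (hop.creation x v) := by
  rw [map_mul, creation_X]
  rfl

theorem creation_C_apply (hop : HeisRel op) (a : ℂ) (v : V) :
    hop.creation (MvPolynomial.C a) v = a • v := by
  rw [← MvPolynomial.algebraMap_eq, AlgHom.commutes]
  rfl

theorem apply_apply (hop : HeisRel op) (m n : ℤ) (v : V) :
    op m (op n v) = op n (op m v) + if m + n = 0 then (m : ℂ) • v else 0 := by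
  rw [← sub_eq_iff_eq_add']
  have := LinearMap.congr_fun (hop m n) v
  split_ifs at this ⊢ <;> exact this

variable {lam : ℂ} {v : V}

theorem apply_zero_creation (hop : HeisRel op) (h0 : op 0 v = lam • v) (x : MvPolynomial ℕ+ ℂ) :
    op 0 (hop.creation x v) = lam • hop.creation x v := by
  induction x using MvPolynomial.induction_on with
  | C a => rw [creation_C_apply, map_smul, h0, smul_comm]
  | add x y hx hy => rw [map_add, LinearMap.add_apply, map_add, smul_add, hx, hy]
  | mul_X x n hx =>
    have := n.pos
    rw [mul_comm, creation_X_mul_apply, map_smul, hop.apply_apply, if_neg (by omega), hx, add_zero,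
      map_smul, smul_comm]

/-- Commuting `h_n` past each factor `x_k = k⁻¹ h_{-k}` gives `δ_{n,k}`, which is the Leibniz rule
for `∂_n`; at the end `h_n` kills `v`. -/
theorem apply_pos_creation (hop : HeisRel op) (hpos : ∀ n : ℤ, 0 < n → op n v = 0) (n : ℕ+)
    (x : MvPolynomial ℕ+ ℂ) :
    op (n : ℕ) (hop.creation x v) = hop.creation (MvPolynomial.pderiv n x) v := by
  have hn := n.pos
  induction x using MvPolynomial.induction_on with
  | C a =>
    rw [creation_C_apply, map_smul, hpos _ (by omega), MvPolynomial.pderiv_C, map_zero, smul_zero]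
    rfl
  | add x y hx hy =>
    rw [map_add, LinearMap.add_apply, map_add, hx, hy, map_add, map_add, LinearMap.add_apply]
  | mul_X x k hx =>
    rw [mul_comm, creation_X_mul_apply, map_smul, hop.apply_apply, hx, Derivation.leibniz,
      map_add, LinearMap.add_apply, smul_eq_mul, creation_X_mul_apply, smul_add]
    congr 1
    rcases eq_or_ne n k with rfl | h
    · rw [if_pos (by omega), MvPolynomial.pderiv_X_self, smul_eq_mul, mul_one, Int.cast_natCast,
        inv_smul_smul₀ (Nat.cast_ne_zero.mpr n.ne_zero)]
    · rw [if_neg (fun h' => h (PNat.coe_injective (by omega))), MvPolynomial.pderiv_X_of_ne h.symm,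
        smul_zero, smul_zero, map_zero]
      rfl

theorem creation_bosonOp (hop : HeisRel op) (hpos : ∀ n : ℤ, 0 < n → op n v = 0)
    (h0 : op 0 v = lam • v) (n : ℤ) (x : MvPolynomial ℕ+ ℂ) :
    hop.creation (bosonOp lam n x) v = op n (hop.creation x v) := by
  rcases n with (_ | k) | k
  · rw [show bosonOp lam (Int.ofNat 0) x = lam • x from rfl, map_smul]
    exact (hop.apply_zero_creation h0 x).symm
  · exact (hop.apply_pos_creation hpos k.succPNat x).symm
  · have := hop.creation_X_mul_apply k.succPNat x v
    rw [show bosonOp lam (Int.negSucc k) x =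
      ((k : ℂ) + 1) • (MvPolynomial.X k.succPNat * x) from rfl, map_smul, LinearMap.smul_apply,
      this, Nat.succPNat_coe, Nat.cast_succ, smul_inv_smul₀ (Nat.cast_add_one_ne_zero k)]
    rfl

theorem creation_heisRep (hop : HeisRel op) (hpos : ∀ n : ℤ, 0 < n → op n v = 0)
    (h0 : op 0 v = lam • v) (z : HeisZ) (x : MvPolynomial ℕ+ ℂ) :
    hop.creation (heisRep (bosonOp lam) z x) v = heisRep op z (hop.creation x v) := by
  rw [heisRep_apply, heisRep_apply, LinearMap.add_apply, LinearMap.add_apply, map_add,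
    LinearMap.add_apply]
  congr 1
  · induction HeisZ.gen z using Finsupp.induction_linear with
    | zero => simp
    | add f g hf hg => simp only [map_add, LinearMap.add_apply, hf, hg]
    | single n a =>
      simp only [Finsupp.linearCombination_single, LinearMap.smul_apply, map_smul,
        hop.creation_bosonOp hpos h0]
  · simp

/-- The homomorphism from `B_lam` that sends `1` to a singular vector `v` of weight `lam`. -/
def bosonHom (hop : HeisRel op) (hpos : ∀ n : ℤ, 0 < n → op n v = 0) (h0 : op 0 v = lam • v) :
    BosonModule lam →ₗ⁅ℂ,HeisZ⁆ HeisModule op hop where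
  toFun x := HeisModule.of op hop
    (hop.creation ((HeisModule.of (bosonOp lam) (bosonOp_rel lam)).symm x) v)
  map_add' x y := by simp
  map_smul' t x := by simp
  map_lie' {z x} := hop.creation_heisRep hpos h0 z x

theorem bosonHom_apply (hop : HeisRel op) (hpos : ∀ n : ℤ, 0 < n → op n v = 0)
    (h0 : op 0 v = lam • v) (x : MvPolynomial ℕ+ ℂ) :
    hop.bosonHom hpos h0 (HeisModule.of (bosonOp lam) (bosonOp_rel lam) x) =
      HeisModule.of op hop (hop.creation x v) := rfl

theorem bosonHom_injective (hop : HeisRel op) (hpos : ∀ n : ℤ, 0 < n → op n v = 0)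
    (h0 : op 0 v = lam • v) (hv : v ≠ 0) : Function.Injective (hop.bosonHom hpos h0) := by
  rw [← LieModuleHom.ker_eq_bot]
  -- `B_λ` is irreducible, so the kernel is zero or everything; the second would force the image `v`
  -- of `1` to vanish.
  refine (IsSimpleOrder.eq_bot_or_eq_top _).resolve_right fun h => hv ?_
  have : HeisModule.of (bosonOp lam) (bosonOp_rel lam) 1 ∈ (hop.bosonHom hpos h0).ker := by
    rw [h]; exact LieSubmodule.mem_top _
  rw [LieModuleHom.mem_ker, bosonHom_apply, map_one] at this
  exact this

end HeisRel

/-- By the modular law, `E i` is `A i` plus its intersection with the sum of the other `A j`, which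
is zero. With `E` the eigenspaces of `h_0`, this identifies both the sectors and the spans of
monomials with them. -/
theorem iSupIndep.eq_of_le_of_iSup_eq_top {ι R M : Type*} [Ring R] [AddCommGroup M] [Module R M]
    {A E : ι → Submodule R M} (hE : iSupIndep E) (hle : ∀ i, A i ≤ E i) (hA : ⨆ i, A i = ⊤) :
    A = E := by
  funext i
  refine le_antisymm (hle i) ?_
  have h₁ : A i ⊔ ⨆ (j) (_ : j ≠ i), A j = ⊤ := by
    rw [eq_top_iff, ← hA]
    refine iSup_le fun j => ?_
    rcases eq_or_ne j i with rfl | h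
    · exact le_sup_left
    · exact le_sup_of_le_right (le_iSup₂_of_le j h le_rfl)
  have h₂ : (⨆ (j) (_ : j ≠ i), A j) ⊓ E i = ⊥ := by
    rw [eq_bot_iff, ← (hE i).eq_bot, inf_comm]
    exact inf_le_inf_left _ (iSup₂_mono fun j _ => hle j)
  have h₃ := sup_inf_assoc_of_le (⨆ (j) (_ : j ≠ i), A j) (hle i)
  rw [h₁, h₂, top_inf_eq, sup_bot_eq] at h₃
  exact h₃.le

theorem DirectSum.bijective_toModule_of_isInternal_range {ι R N : Type*} [DecidableEq ι] [Ring R]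
    [AddCommGroup N] [Module R N] {M : ι → Type*} [∀ i, AddCommGroup (M i)] [∀ i, Module R (M i)]
    (f : ∀ i, M i →ₗ[R] N) (hf : ∀ i, Function.Injective (f i))
    (h : DirectSum.IsInternal fun i => LinearMap.range (f i)) :
    Function.Bijective (DirectSum.toModule R ι N f) := by
  have : DirectSum.toModule R ι N f = (DirectSum.coeLinearMap fun i => LinearMap.range (f i)) ∘ₗ
      (DFinsupp.mapRange.linearEquiv fun i => LinearEquiv.ofInjective (f i) (hf i)).toLinearMap := by
    refine DirectSum.linearMap_ext R fun i => LinearMap.ext fun x => ?_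
    simp only [LinearMap.comp_apply, DirectSum.toModule_lof, LinearEquiv.coe_coe]
    erw [DFinsupp.mapRange.linearEquiv_apply, DFinsupp.mapRange_single]
    exact (DirectSum.coeLinearMap_lof (fun i => LinearMap.range (f i)) i
      (LinearEquiv.ofInjective (f i) (hf i) x)).symm
  rw [this, LinearMap.coe_comp]
  exact h.comp (LinearEquiv.bijective _)

/-- An injective homomorphism of Lie modules is an isomorphism onto its range. -/
def LieModuleHom.equivRangeOfInjective {R L M N : Type*} [CommRing R] [LieRing L] [LieAlgebra R L]
    [AddCommGroup M] [Module R M] [LieRingModule L M] [LieModule R L M]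
    [AddCommGroup N] [Module R N] [LieRingModule L N] [LieModule R L N] (f : M →ₗ⁅R,L⁆ N)
    (hf : Function.Injective f) : M ≃ₗ⁅R,L⁆ f.range :=
  { LinearEquiv.ofBijective ((f : M →ₗ[R] N).codRestrict f.range.toSubmodule fun x => ⟨x, rfl⟩)
      ⟨fun _ _ h => hf (congrArg Subtype.val h), fun ⟨_, x, hx⟩ => ⟨x, Subtype.ext hx⟩⟩ with
    map_lie' := fun {x v} => Subtype.ext (f.map_lie x v) }

theorem LieModuleHom.coe_equivRangeOfInjective_apply {R L M N : Type*} [CommRing R] [LieRing L]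
    [LieAlgebra R L] [AddCommGroup M] [Module R M] [LieRingModule L M] [LieModule R L M]
    [AddCommGroup N] [Module R N] [LieRingModule L N] [LieModule R L N] (f : M →ₗ⁅R,L⁆ N)
    (hf : Function.Injective f) (x : M) : (f.equivRangeOfInjective hf x : N) = f x := rfl

/-- A Lie module that is the internal direct sum of the ranges of injective homomorphisms `f i` is
isomorphic to the direct sum of their sources. -/
def DirectSum.lieModuleEquivOfIsInternal {ι R L N : Type*} [DecidableEq ι] [CommRing R] [LieRing L]
    [LieAlgebra R L] [AddCommGroup N] [Module R N] [LieRingModule L N] [LieModule R L N]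
    {M : ι → Type*} [∀ i, AddCommGroup (M i)] [∀ i, Module R (M i)] [∀ i, LieRingModule L (M i)]
    [∀ i, LieModule R L (M i)] (f : ∀ i, M i →ₗ⁅R,L⁆ N) (hf : ∀ i, Function.Injective (f i))
    (h : DirectSum.IsInternal fun i => (f i).range.toSubmodule) : (⨁ i, M i) ≃ₗ⁅R,L⁆ N :=
  { LinearEquiv.ofBijective (DirectSum.toModule R ι N fun i => (f i : M i →ₗ[R] N))
      (DirectSum.bijective_toModule_of_isInternal_range _ hf
        (by simpa only [LieModuleHom.toSubmodule_range] using h)) with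
    map_lie' := by
      intro x m
      change DirectSum.toModule R ι N (fun i => (f i : M i →ₗ[R] N)) ⁅x, m⁆ =
        ⁅x, DirectSum.toModule R ι N (fun i => (f i : M i →ₗ[R] N)) m⁆
      induction m using DirectSum.induction_on with
      | zero => simp
      | add m₁ m₂ h₁ h₂ => rw [lie_add, map_add, map_add, lie_add, h₁, h₂]
      | of i m =>
        have h₁ : ⁅x, DirectSum.lof R ι M i m⁆ = DirectSum.lof R ι M i ⁅x, m⁆ :=
          ((DirectSum.lieModuleOf R ι L M i).map_lie x m).symm
        change DirectSum.toModule R ι N _ ⁅x, DirectSum.lof R ι M i m⁆ =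
          ⁅x, DirectSum.toModule R ι N _ (DirectSum.lof R ι M i m)⁆
        rw [h₁, DirectSum.toModule_lof, DirectSum.toModule_lof]
        exact (f i).map_lie x m }

/-! ### The boson-fermion correspondence -/

namespace ChargedFermions

variable {V : Type*} [AddCommGroup V] [Module ℂ V] (C : ChargedFermions V)

/-- The Heisenberg submodule generated by the vacuum of charge `m`. -/
def sector (m : ℤ) : Submodule ℂ V :=
  LinearMap.range (C.current_rel.creation.toLinearMap.flip (C.chargedVac m))

variable {C}

theorem creation_mem_sector (m : ℤ) (x : MvPolynomial ℕ+ ℂ) :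
    C.current_rel.creation x (C.chargedVac m) ∈ C.sector m := ⟨x, rfl⟩

theorem chargedVac_mem_sector (m : ℤ) : C.chargedVac m ∈ C.sector m :=
  ⟨1, by simp⟩

theorem current_neg_mem_sector {m : ℤ} {w : V} (hw : w ∈ C.sector m) {n : ℤ} (hn : n < 0) :
    C.current n w ∈ C.sector m := by
  obtain ⟨x, rfl⟩ := hw
  obtain ⟨k, rfl⟩ : ∃ k : ℕ+, n = -((k : ℕ) : ℤ) := 
    ⟨⟨n.natAbs, by omega⟩, by rw [PNat.mk_coe]; omega⟩
  have := (C.sector m).smul_mem (k : ℂ) (creation_mem_sector m (MvPolynomial.X k * x))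
  rwa [C.current_rel.creation_X_mul_apply, smul_inv_smul₀ (Nat.cast_ne_zero.mpr k.ne_zero)] at this

theorem sector_le {m : ℤ} {S : Submodule ℂ V} (hv : C.chargedVac m ∈ S)
    (hS : ∀ n < 0, ∀ w ∈ S, C.current n w ∈ S) : C.sector m ≤ S := by
  rintro _ ⟨x, rfl⟩
  change C.current_rel.creation x (C.chargedVac m) ∈ S
  induction x using MvPolynomial.induction_on with
  | C a => rw [C.current_rel.creation_C_apply]; exact S.smul_mem a hv
  | add x y hx hy => rw [map_add, LinearMap.add_apply]; exact S.add_mem hx hy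
  | mul_X x n hx =>
    have := n.pos
    rw [mul_comm, C.current_rel.creation_X_mul_apply]
    exact S.smul_mem _ (hS _ (by omega) _ hx)

/-- Write `j = -m-1-k`. For `k = 0` the vector is the next charged vacuum; for `k > 0`,
`smul_p_chargedVac` can be divided by `k` and expresses it through negative currents applied to
cases of smaller `k`. -/
theorem p_chargedVac_mem_sector (m j : ℤ) : C.p.mode j (C.chargedVac m) ∈ C.sector (m + 1) := by
  rcases le_or_gt (-m) j with h | h
  · rw [C.p_chargedVac_of_ge m j h]; exact zero_mem _
  obtain ⟨k, hk⟩ := Int.eq_ofNat_of_zero_le (show 0 ≤ -m - 1 - j by omega)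
  obtain rfl : j = -m - 1 - k := by omega
  clear h hk
  induction k using Nat.strong_induction_on with
  | _ k ih =>
    rcases Nat.eq_zero_or_pos k with rfl | hk
    · rw [Nat.cast_zero, sub_zero, C.p_chargedVac]
      exact chargedVac_mem_sector _
    · have hk0 : (k : ℂ) ≠ 0 := Nat.cast_ne_zero.mpr hk.ne'
      rw [← inv_smul_smul₀ hk0 (C.p.mode _ _), C.smul_p_chargedVac]
      refine Submodule.smul_mem _ _ (Submodule.sum_mem _ fun i hi => ?_)
      rw [Finset.mem_Ico] at hi
      refine current_neg_mem_sector ?_ (by omega)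
      have := ih (-m - 1 - i).toNat (by omega)
      rwa [show -m - 1 - ((-m - 1 - i).toNat : ℤ) = i by omega] at this

theorem p_mem_sector {m : ℤ} {w : V} (hw : w ∈ C.sector m) (j : ℤ) :
    C.p.mode j w ∈ C.sector (m + 1) := by
  -- All `j` must be treated at once, since commuting `p_j` with `h_n` produces `p_{n+j}`.
  let S : Submodule ℂ V := ⨅ j, (C.sector (m + 1)).comap (C.p.mode j)
  have hS {w : V} : w ∈ S ↔ ∀ j, C.p.mode j w ∈ C.sector (m + 1) := by
    simp [S, Submodule.mem_iInf]
  refine hS.mp (sector_le (hS.mpr fun j => p_chargedVac_mem_sector m j) (fun n hn w hw => ?_) hw) j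
  rw [hS] at hw ⊢
  intro j
  rw [eq_sub_of_add_eq (C.current_p_apply n j w).symm]
  exact Submodule.sub_mem _ (current_neg_mem_sector (hw j) hn) (hw _)

variable (C) in
theorem conj_sector_le (m : ℤ) : C.conj.sector m ≤ C.sector (-m) := by
  refine sector_le ?_ fun n hn w hw => ?_
  · rw [conj_chargedVac]
    exact chargedVac_mem_sector _
  · rw [conj_current]
    exact Submodule.neg_mem _ (current_neg_mem_sector hw hn)

theorem q_mem_sector {m : ℤ} {w : V} (hw : w ∈ C.sector m) (j : ℤ) :
    C.q.mode j w ∈ C.sector (m - 1) := by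
  -- Conjugating twice gives back `C` definitionally, so `hw` is also a statement about
  -- `C.conj.conj`.
  have h₁ : w ∈ C.conj.sector (-m) := C.conj.conj_sector_le m hw
  have h₂ := C.conj_sector_le _ (p_mem_sector h₁ j)
  rwa [show -(-m + 1) = m - 1 by ring] at h₂

variable (C)

/-- The modes of `p` and `q` shift sectors by `±1`, so the sum of all sectors is stable under them
and contains the cyclic vacuum. -/
theorem iSup_sector : ⨆ m, C.sector m = ⊤ := by
  refine C.cyclic _ (Submodule.mem_iSup_of_mem 0 (chargedVac_mem_sector 0)) fun n v hv => ?_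
  constructor
  · refine Submodule.iSup_induction (motive := fun v => C.p.mode n v ∈ ⨆ m, C.sector m) _ hv
      (fun m w hw => Submodule.mem_iSup_of_mem _ (p_mem_sector hw n)) (by simp) fun v w h₁ h₂ => ?_
    rw [map_add]
    exact Submodule.add_mem _ h₁ h₂
  · refine Submodule.iSup_induction (motive := fun v => C.q.mode n v ∈ ⨆ m, C.sector m) _ hv
      (fun m w hw => Submodule.mem_iSup_of_mem _ (q_mem_sector hw n)) (by simp) fun v w h₁ h₂ => ?_
    rw [map_add]
    exact Submodule.add_mem _ h₁ h₂

theorem current_zero_chargedVac (m : ℤ) :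
    C.current 0 (C.chargedVac m) = (m : ℂ) • C.chargedVac m := by
  rw [C.current_chargedVac m 0 le_rfl, if_pos rfl]

theorem current_pos_chargedVac (m n : ℤ) (hn : 0 < n) : C.current n (C.chargedVac m) = 0 := by
  rw [C.current_chargedVac m n hn.le, if_neg hn.ne', zero_smul]

theorem sector_le_eigenspace (m : ℤ) :
    C.sector m ≤ Module.End.eigenspace (C.current 0) (m : ℂ) := by
  rintro _ ⟨x, rfl⟩
  rw [Module.End.mem_eigenspace_iff]
  exact C.current_rel.apply_zero_creation (C.current_zero_chargedVac m) x

theorem iSupIndep_eigenspace :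
    iSupIndep fun m : ℤ => Module.End.eigenspace (C.current 0) (m : ℂ) :=
  (Module.End.eigenspaces_iSupIndep (C.current 0)).comp Int.cast_injective

theorem sector_eq_eigenspace (m : ℤ) :
    C.sector m = Module.End.eigenspace (C.current 0) (m : ℂ) :=
  congrFun (C.iSupIndep_eigenspace.eq_of_le_of_iSup_eq_top C.sector_le_eigenspace C.iSup_sector) m

/-- The homomorphism from `B_m` that sends `1` to the vacuum of charge `m`. -/
def bosonHom (m : ℤ) : BosonModule (m : ℂ) →ₗ⁅ℂ,HeisZ⁆ HeisModule C.current C.current_rel :=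
  C.current_rel.bosonHom (C.current_pos_chargedVac m) (C.current_zero_chargedVac m)

theorem bosonHom_injective (m : ℤ) : Function.Injective (C.bosonHom m) :=
  C.current_rel.bosonHom_injective _ _ (C.chargedVac_ne_zero m)

theorem mem_range_bosonHom (m : ℤ) (v : V) :
    HeisModule.of C.current C.current_rel v ∈ (C.bosonHom m).range ↔ v ∈ C.sector m := by
  rw [LieModuleHom.mem_range]
  rfl

theorem isInternal_range_bosonHom :
    DirectSum.IsInternal fun m => (C.bosonHom m).range.toSubmodule := by
  have h : (DirectSum.IsInternal fun m => C.sector m) :=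
    DirectSum.isInternal_submodule_of_iSupIndep_of_iSup_eq_top
      (C.iSupIndep_eigenspace.mono C.sector_le_eigenspace) C.iSup_sector
  exact h

/-- `B_m` is isomorphic to the sector of charge `m`. -/
def bosonEquiv (m : ℤ) : BosonModule (m : ℂ) ≃ₗ⁅ℂ,HeisZ⁆ (C.bosonHom m).range :=
  (C.bosonHom m).equivRangeOfInjective (C.bosonHom_injective m)

theorem isIrreducible_range_bosonHom (m : ℤ) :
    LieModule.IsIrreducible ℂ HeisZ (C.bosonHom m).range :=
  (LieSubmodule.orderIsoMapComap (C.bosonEquiv m)).isSimpleOrder_iff.mp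
    BosonModule.isIrreducible

theorem isHeisHighestWeightVector_chargedVac (m : ℤ) :
    ∃ hv : HeisModule.of C.current C.current_rel (C.chargedVac m) ∈ (C.bosonHom m).range,
      IsHeisHighestWeightVector (m : ℂ)
        (⟨HeisModule.of C.current C.current_rel (C.chargedVac m), hv⟩ : (C.bosonHom m).range) := by
  refine ⟨(C.mem_range_bosonHom m _).mpr (chargedVac_mem_sector m), ?_⟩
  -- The charged vacuum is the image of `1 ∈ B_m`, where all highest weight properties are known.
  convert (BosonModule.isHeisHighestWeightVector_one (lam := m)).map_equiv (C.bosonEquiv m) using 1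
  refine Subtype.ext ?_
  rw [bosonEquiv, LieModuleHom.coe_equivRangeOfInjective_apply]
  refine (congrArg (fun A : Module.End ℂ V => HeisModule.of C.current C.current_rel
    (A (C.chargedVac m))) (map_one C.current_rel.creation)).symm

/-- The boson-fermion correspondence. -/
def directSumBosonEquiv :
    (⨁ m : ℤ, BosonModule (m : ℂ)) ≃ₗ⁅ℂ,HeisZ⁆ HeisModule C.current C.current_rel :=
  DirectSum.lieModuleEquivOfIsInternal C.bosonHom C.bosonHom_injective C.isInternal_range_bosonHom

end ChargedFermions

/-! ### Fock spaces of mode Clifford algebras -/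

section Fock

variable {ι : Type} {τ : ι → ι} {ann : Set ι}

theorem fockOp_anticomm (hτ : Function.Involutive τ) (i j : ι) [Decidable (j = τ i)] :
    fockOp τ ann i * fockOp τ ann j + fockOp τ ann j * fockOp τ ann i =
      if j = τ i then 1 else 0 := by
  unfold fockOp
  rw [← map_mul, ← map_mul, ← map_add, cliffMode_anticomm τ hτ]
  split_ifs <;> simp

theorem Fock.eq_top_of_fockOp_mem (S : Submodule ℂ (Fock τ ann)) (hvac : vacuum τ ann ∈ S)
    (hS : ∀ i, ∀ v ∈ S, fockOp τ ann i v ∈ S) : S = ⊤ := by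
  have hgen : ∀ (f : ι →₀ ℂ) (w : Fock τ ann), w ∈ S → CliffordAlgebra.ι (modeQuad τ) f • w ∈ S := by
    intro f w hw
    induction f using Finsupp.induction_linear with
    | zero => simp
    | add f₁ f₂ h₁ h₂ => rw [map_add, add_smul]; exact S.add_mem h₁ h₂
    | single i a =>
      have : (Finsupp.single i a : ι →₀ ℂ) = a • Finsupp.single i 1 := by simp
      rw [this, map_smul, smul_assoc]
      exact S.smul_mem a (hS i w hw)
  have hall : ∀ (x : ModeClifford τ) (w : Fock τ ann), w ∈ S → x • w ∈ S := by
    intro x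
    induction x using CliffordAlgebra.induction with
    | algebraMap r => intro w hw; rw [algebraMap_smul]; exact S.smul_mem r hw
    | ι f => exact hgen f
    | mul a b ha hb => intro w hw; rw [mul_smul]; exact ha _ (hb _ hw)
    | add a b ha hb => intro w hw; rw [add_smul]; exact S.add_mem (ha _ hw) (hb _ hw)
  rw [eq_top_iff]
  intro v _
  obtain ⟨x, rfl⟩ : ∃ x, Fock.proj τ ann x = v := Submodule.Quotient.mk_surjective _ v
  rw [← smul_vacuum]
  exact hall x _ hvac

open scoped Classical in
variable (τ ann) in
/-- The mode `e_i` acts on the exterior algebra by multiplication if it is a creation operator and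
by contraction if it is an annihilation operator. -/
def exteriorMode (i : ι) : Module.End ℂ (ExteriorAlgebra ℂ (ι →₀ ℂ)) :=
  if i ∈ ann then
    CliffordAlgebra.contractLeft (Q := (0 : QuadraticForm ℂ (ι →₀ ℂ))) (Finsupp.lapply (τ i))
  else LinearMap.mulLeft ℂ (ExteriorAlgebra.ι ℂ (Finsupp.single i 1))

open scoped Classical in
-- Contractions anticommute, as do multiplications by vectors, and a contraction is an
-- antiderivation, which yields the mixed relation. As `τ` exchanges annihilators and creators, two
-- modes of the same kind are never dual.
theorem exteriorMode_anticomm (hτ : Function.Involutive τ) (hann : ∀ i, τ i ∈ ann ↔ i ∉ ann)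
    (i j : ι) : exteriorMode τ ann i * exteriorMode τ ann j +
      exteriorMode τ ann j * exteriorMode τ ann i = if j = τ i then 1 else 0 := by
  have hmixed : ∀ i j, i ∈ ann → j ∉ ann → exteriorMode τ ann i * exteriorMode τ ann j +
      exteriorMode τ ann j * exteriorMode τ ann i = if j = τ i then 1 else 0 := by
    intro i j hi hj
    refine LinearMap.ext fun x => ?_
    unfold exteriorMode
    rw [if_pos hi, if_neg hj]
    change CliffordAlgebra.contractLeft _ (CliffordAlgebra.ι _ _ * x) +
      CliffordAlgebra.ι _ _ * CliffordAlgebra.contractLeft _ x = _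
    rw [CliffordAlgebra.contractLeft_ι_mul, sub_add_cancel, Finsupp.lapply_apply,
      Finsupp.single_apply]
    split_ifs <;> simp
  by_cases hi : i ∈ ann <;> by_cases hj : j ∈ ann
  · rw [if_neg (fun h : j = τ i => (hann i).mp (h ▸ hj) hi)]
    refine LinearMap.ext fun x => ?_
    unfold exteriorMode
    rw [if_pos hi, if_pos hj]
    change CliffordAlgebra.contractLeft _ (CliffordAlgebra.contractLeft _ x) +
      CliffordAlgebra.contractLeft _ (CliffordAlgebra.contractLeft _ x) = 0
    rw [CliffordAlgebra.contractLeft_comm, neg_add_cancel]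
  · exact hmixed i j hi hj
  · rw [add_comm, hmixed j i hj hi]
    exact if_congr ⟨fun h => by rw [h, hτ], fun h => by rw [h, hτ]⟩ rfl rfl
  · rw [if_neg (fun h : j = τ i => hj (h ▸ (hann i).mpr hi))]
    refine LinearMap.ext fun x => ?_
    unfold exteriorMode
    rw [if_neg hi, if_neg hj]
    change ExteriorAlgebra.ι ℂ _ * (ExteriorAlgebra.ι ℂ _ * x) +
      ExteriorAlgebra.ι ℂ _ * (ExteriorAlgebra.ι ℂ _ * x) = 0
    rw [← mul_assoc, ← mul_assoc, ← add_mul, ExteriorAlgebra.ι_add_mul_swap, zero_mul]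

theorem exteriorMode_linearCombination_sq (hτ : Function.Involutive τ)
    (hann : ∀ i, τ i ∈ ann ↔ i ∉ ann) (f : ι →₀ ℂ) :
    Finsupp.linearCombination ℂ (exteriorMode τ ann) f *
      Finsupp.linearCombination ℂ (exteriorMode τ ann) f =
        algebraMap ℂ _ (modeQuad τ f) := by
  classical
  set T := Finsupp.linearCombination ℂ (exteriorMode τ ann)
  -- The polarized identity is bilinear and can be checked on basis vectors; taking `f = g` and
  -- halving gives the square.
  have key : ∀ f g : ι →₀ ℂ, T f * T g + T g * T f = modeForm τ f g • 1 := by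
    intro f g
    induction f using Finsupp.induction_linear with
    | zero => simp
    | add f₁ f₂ h₁ h₂ =>
      rw [map_add, map_add, LinearMap.add_apply, add_smul, ← h₁, ← h₂, add_mul, mul_add]; abel
    | single i a =>
      induction g using Finsupp.induction_linear with
      | zero => simp
      | add g₁ g₂ h₁ h₂ => rw [map_add, map_add, add_smul, ← h₁, ← h₂, add_mul, mul_add]; abel
      | single j b =>
        have h := congrArg (fun A => (a * b) • A) (exteriorMode_anticomm hτ hann i j)
        simp only [smul_add] at h
        simp only [T, Finsupp.linearCombination_single]
        rw [smul_mul_smul_comm, smul_mul_smul_comm, mul_comm b a, h]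
        simp only [modeForm, Finsupp.linearCombination_single, LinearMap.smul_apply,
          Finsupp.lapply_apply, Finsupp.single_apply]
        split_ifs <;> simp
  have h₂ := congrArg (fun A => (2⁻¹ : ℂ) • A) (key f f)
  rw [← two_smul ℂ (T f * T f), inv_smul_smul₀ two_ne_zero, smul_smul] at h₂
  rw [h₂, Algebra.algebraMap_eq_smul_one]
  rfl

/-- In the exterior algebra the left ideal generated by the annihilators kills `1`. A zero vacuum
would put the unit into that ideal, forcing `1 = 0` there. -/
theorem vacuum_ne_zero (hτ : Function.Involutive τ) (hann : ∀ i, τ i ∈ ann ↔ i ∉ ann) :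
    vacuum τ ann ≠ 0 := by
  let ρ : ModeClifford τ →ₐ[ℂ] Module.End ℂ (ExteriorAlgebra ℂ (ι →₀ ℂ)) :=
    CliffordAlgebra.lift (modeQuad τ)
      ⟨Finsupp.linearCombination ℂ (exteriorMode τ ann),
        exteriorMode_linearCombination_sq hτ hann⟩
  have hρ (i : ι) : ρ (cliffMode τ i) = exteriorMode τ ann i := by
    simp [ρ, cliffMode]
  have hker : ∀ x ∈ Submodule.span (ModeClifford τ) (cliffMode τ '' ann), ρ x 1 = 0 := by
    intro x hx
    induction hx using Submodule.span_induction with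
    | mem x hx =>
      obtain ⟨i, hi, rfl⟩ := hx
      rw [hρ, exteriorMode, if_pos hi]
      exact CliffordAlgebra.contractLeft_one (Q := (0 : QuadraticForm ℂ (ι →₀ ℂ))) _
    | zero => simp
    | add x y _ _ hx hy => rw [map_add, LinearMap.add_apply, hx, hy, add_zero]
    | smul a x _ hx => rw [smul_eq_mul, map_mul, Module.End.mul_apply, hx, map_zero]
  intro h
  have h₁ := hker 1 ((Submodule.Quotient.mk_eq_zero _).1 h)
  rw [map_one ρ, Module.End.one_apply] at h₁
  exact one_ne_zero h₁

end Fock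

/-! ### The charged fermions on `F^{⊗1}` -/

theorem psiA_anticomm (s t : Bool) (a b : ℤ) :
    (psiA s).mode a * (psiA t).mode b + (psiA t).mode b * (psiA s).mode a =
      if t = !s ∧ a + b = -1 then 1 else 0 := by
  have := fockOp_anticomm (ann := {i : Bool × ℤ | 0 ≤ i.2}) conjA_invol (s, a) (t, b)
  refine Eq.trans this (if_congr ?_ rfl rfl)
  rw [conjA, Prod.mk.injEq]
  exact and_congr_right fun _ => ⟨fun h => by omega, fun h => by omega⟩

/-- The charged fermions `ψ⁺`, `ψ⁻` on `F^{⊗1}`. -/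
def fermionsA : ChargedFermions FockA where
  p := psiA true
  q := psiA false
  p_p a b := by rw [psiA_anticomm]; simp
  q_q a b := by rw [psiA_anticomm]; simp
  p_q a b := by rw [psiA_anticomm]; simp
  vac := vacuum conjA {i | 0 ≤ i.2}
  p_vac n hn := fockOp_vacuum _ _ (i := (true, n)) hn
  q_vac n hn := fockOp_vacuum _ _ (i := (false, n)) hn
  vac_ne_zero := vacuum_ne_zero conjA_invol fun i => by
    simp only [conjA, Set.mem_ofPred_eq]; omega
  cyclic S h₀ h := Fock.eq_top_of_fockOp_mem S h₀ fun i v hv => by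
    obtain ⟨s, n⟩ := i
    cases s
    · exact (h n v hv).2
    · exact (h n v hv).1

/-! ### The charged fermions on `F^{⊗1/2}` -/

theorem phiD_anticomm (i j : ℤ) :
    phiD.mode i * phiD.mode j + phiD.mode j * phiD.mode i = if i + j = -1 then 1 else 0 := by
  have := fockOp_anticomm (ann := {i : ℤ | 0 ≤ i}) conjD_invol i j
  refine Eq.trans this (if_congr ?_ rfl rfl)
  rw [conjD]
  exact ⟨fun h => by omega, fun h => by omega⟩

/-- The field with modes `a_{2 n + r}`. -/
def QField.parityPart {V : Type*} [AddCommGroup V] [Module ℂ V] (a : QField V) (r : ℤ) : QField V where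
  mode n := a.mode (2 * n + r)
  truncated v := by
    obtain ⟨N, hN⟩ := a.truncated v
    exact ⟨max 0 (N - r), fun n hn => hN _ (by omega)⟩

/-- The charged fermions on `F^{⊗1/2}` given by the even and the odd modes of `φ(z)`. -/
def fermionsD : ChargedFermions FockD where
  p := phiD.parityPart 0
  q := phiD.parityPart 1
  p_p a b := (phiD_anticomm _ _).trans (if_neg (by omega))
  q_q a b := (phiD_anticomm _ _).trans (if_neg (by omega))
  p_q a b := (phiD_anticomm _ _).trans
    (if_congr ⟨fun h => by omega, fun h => by omega⟩ rfl rfl)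
  vac := vacuum conjD {j | 0 ≤ j}
  p_vac n hn := fockOp_vacuum _ _ (by simp only [Set.mem_ofPred_eq]; omega)
  q_vac n hn := fockOp_vacuum _ _ (by simp only [Set.mem_ofPred_eq]; omega)
  vac_ne_zero := vacuum_ne_zero conjD_invol fun i => by
    simp only [conjD, Set.mem_ofPred_eq]; omega
  cyclic S h₀ h := Fock.eq_top_of_fockOp_mem S h₀ fun i v hv => by
    obtain ⟨k, rfl | rfl⟩ := i.even_or_odd'
    · have := (h k v hv).1
      rwa [show (phiD.parityPart 0).mode k = phiD.mode (2 * k) by simp [QField.parityPart]] at this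
    · exact (h k v hv).2

theorem fermionsD_p_mode (n : ℤ) : fermionsD.p.mode n = phiD.mode (2 * n) := by
  change phiD.mode (2 * n + 0) = _
  rw [add_zero]

theorem fermionsD_q_mode (n : ℤ) : fermionsD.q.mode n = phiD.mode (2 * n + 1) := rfl

theorem finsum_int_eq_add {M : Type*} [AddCommMonoid M] (f : ℤ → M) (hf : f.support.Finite) :
    ∑ᶠ p : ℤ, f p = ∑ᶠ a : ℤ, f (2 * a) + ∑ᶠ a : ℤ, f (2 * a + 1) := by
  have h₀ : Function.Injective fun a : ℤ => 2 * a := fun a b h => by simp only at h; omega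
  have h₁ : Function.Injective fun a : ℤ => 2 * a + 1 := fun a b h => by simp only at h; omega
  rw [← finsum_mem_range h₀, ← finsum_mem_range h₁,
    ← finsum_mem_union' _ (hf.subset Set.inter_subset_right) (hf.subset Set.inter_subset_right),
    Set.eq_univ_of_forall (s := _ ∪ _), finsum_mem_univ]
  · intro p
    obtain ⟨k, rfl | rfl⟩ := p.even_or_odd'
    · exact Or.inl ⟨k, rfl⟩
    · exact Or.inr ⟨k, rfl⟩
  · rw [Set.disjoint_left]
    rintro _ ⟨a, rfl⟩ ⟨b, hb⟩
    simp only at hb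
    omega

theorem normalOrder_phiD_reflect (p q : ℤ) :
    QField.normalOrder phiD phiD.reflect p q =
      ((-1 : ℂ) ^ (-q - 1)) • QField.normalOrder phiD phiD p q := by
  unfold QField.normalOrder QField.reflect
  split_ifs
  · exact mul_smul_comm _ _ _
  · rw [smul_neg]
    exact congrArg Neg.neg (smul_mul_assoc _ _ _)

theorem normalOrder_phiD_even (a b : ℤ) :
    QField.normalOrder phiD phiD (2 * a) (2 * b + 1) =
      QField.normalOrder fermionsD.p fermionsD.q a b := by
  unfold QField.normalOrder
  rw [fermionsD_p_mode, fermionsD_q_mode]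
  exact if_congr ⟨fun h => by omega, fun h => by omega⟩ rfl rfl

/-- The indices `p` and `q = 2n-1-p` have opposite parity. Even `p` carries sign `+1` and gives
`:p_a q_b:`; odd `p` carries `-1`, which swapping the two factors undoes. Each half is the full
current, cancelling the factor `1/2`. -/
theorem hD_eq_current : hD = fermionsD.current := by
  funext n
  refine LinearMap.ext fun v => ?_
  have heven (a : ℤ) : QField.normalOrder phiD phiD.reflect (2 * a) (2 * n - 1 - 2 * a) v =
      QField.normalOrder fermionsD.p fermionsD.q a (n - 1 - a) v := by
    rw [normalOrder_phiD_reflect, Even.neg_one_zpow ⟨a - n, by ring⟩, one_smul,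
      ← normalOrder_phiD_even]
    congr 3
    ring
  have hodd (a : ℤ) :
      QField.normalOrder phiD phiD.reflect (2 * a + 1) (2 * n - 1 - (2 * a + 1)) v =
        QField.normalOrder fermionsD.p fermionsD.q (n - 1 - a) (n - 1 - (n - 1 - a)) v := by
    rw [normalOrder_phiD_reflect, Odd.neg_one_zpow ⟨a - n, by ring⟩, ← normalOrder_phiD_even,
      show 2 * n - 1 - (2 * a + 1) = 2 * (n - 1 - a) by ring,
      show 2 * (n - 1 - (n - 1 - a)) + 1 = 2 * a + 1 by ring,
      QField.normalOrder_swap (fun h => (phiD_anticomm _ _).trans (if_neg h)), neg_smul, one_smul,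
      neg_neg]
  change (2⁻¹ : ℂ) • ∑ᶠ p : ℤ, QField.normalOrder phiD phiD.reflect p (2 * n - 1 - p) v =
    ∑ᶠ a : ℤ, QField.normalOrder fermionsD.p fermionsD.q a (n - 1 - a) v
  rw [finsum_int_eq_add _ (QField.normalOrder_finite phiD phiD.reflect (2 * n) v),
    finsum_congr heven, finsum_congr hodd,
    show ∑ᶠ a : ℤ, QField.normalOrder fermionsD.p fermionsD.q (n - 1 - a)
      (n - 1 - (n - 1 - a)) v = _ from finsum_comp_equiv (Equiv.subLeft (n - 1))
      (f := fun a => QField.normalOrder fermionsD.p fermionsD.q a (n - 1 - a) v),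
    ← two_smul ℂ, inv_smul_smul₀ two_ne_zero]

/-! ### The monomial basis of `F^{⊗1/2}` -/

theorem monomialD_nil : monomialD [] = fermionsD.vac := rfl

theorem monomialD_cons (n : ℕ) (l : List ℕ) :
    monomialD (n :: l) = phiD.mode (-(n : ℤ) - 1) (monomialD l) := rfl

theorem phiD_mode_apply (i j : ℤ) (v : FockD) : phiD.mode i (phiD.mode j v) =
    (if i + j = -1 then v else 0) - phiD.mode j (phiD.mode i v) := by
  rw [eq_sub_iff_add_eq]
  have := LinearMap.congr_fun (phiD_anticomm i j) v
  split_ifs at this ⊢ <;> exact this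

/-- Sorted insertion by anticommuting, with zero if `c` already occurs. The bound on the entries of
`l'` keeps the list decreasing when a larger entry is put back in front. -/
theorem phiD_creation_monomialD (c : ℕ) (l : List ℕ) (hl : l.Pairwise (· > ·)) :
    phiD.mode (-(c : ℤ) - 1) (monomialD l) = 0 ∨
      ∃ l' : List ℕ, l'.Pairwise (· > ·) ∧ (∀ x ∈ l', x = c ∨ x ∈ l) ∧
        (phiD.mode (-(c : ℤ) - 1) (monomialD l) = monomialD l' ∨
          phiD.mode (-(c : ℤ) - 1) (monomialD l) = -monomialD l') := by
  induction l with
  | nil => exact Or.inr ⟨[c], by simp, by simp, Or.inl rfl⟩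
  | cons n l ih =>
    rw [List.pairwise_cons] at hl
    rcases lt_trichotomy n c with h | rfl | h
    · refine Or.inr ⟨c :: n :: l, ?_, by simp, Or.inl rfl⟩
      rw [List.pairwise_cons, List.pairwise_cons]
      refine ⟨fun x hx => ?_, hl⟩
      rcases List.mem_cons.mp hx with rfl | hx
      · exact h
      · exact (hl.1 x hx).trans h
    · left
      have := phiD_mode_apply (-(n : ℤ) - 1) (-(n : ℤ) - 1) (monomialD l)
      rw [if_neg (by omega), zero_sub] at this
      exact eq_zero_of_eq_neg_self this
    · rw [monomialD_cons, phiD_mode_apply, if_neg (by omega), zero_sub]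
      rcases ih hl.2 with h0 | ⟨l', hl', hmem, hsign⟩
      · left; rw [h0, map_zero, neg_zero]
      · refine Or.inr ⟨n :: l', ?_, ?_, ?_⟩
        · rw [List.pairwise_cons]
          refine ⟨fun x hx => ?_, hl'⟩
          rcases hmem x hx with rfl | hx
          · exact h
          · exact hl.1 x hx
        · intro x hx
          rw [List.mem_cons] at hx ⊢
          rcases hx with rfl | hx
          · exact Or.inr (Or.inl rfl)
          · exact (hmem x hx).imp_right Or.inr
        · rcases hsign with h' | h'
          · right; rw [h', monomialD_cons]
          · left; rw [h', map_neg, neg_neg, monomialD_cons]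

theorem span_monomialD :
    Submodule.span ℂ {v | ∃ l : List ℕ, l.Pairwise (· > ·) ∧ v = monomialD l} = ⊤ := by
  set S := Submodule.span ℂ {v | ∃ l : List ℕ, l.Pairwise (· > ·) ∧ v = monomialD l}
  have hmon {l : List ℕ} (hl : l.Pairwise (· > ·)) : monomialD l ∈ S :=
    Submodule.subset_span ⟨l, hl, rfl⟩
  have hspan {A : Module.End ℂ FockD}
      (h : ∀ l : List ℕ, l.Pairwise (· > ·) → A (monomialD l) ∈ S) : ∀ v ∈ S, A v ∈ S := by
    refine (Submodule.span_le (p := S.comap A)).mpr ?_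
    rintro _ ⟨l, hl, rfl⟩
    exact h l hl
  have hcre (c : ℕ) : ∀ v ∈ S, phiD.mode (-(c : ℤ) - 1) v ∈ S := by
    refine hspan fun l hl => ?_
    rcases phiD_creation_monomialD c l hl with h | ⟨l', hl', -, h | h⟩
    · rw [h]; exact S.zero_mem
    · rw [h]; exact hmon hl'
    · rw [h]; exact S.neg_mem (hmon hl')
  have hann (j : ℤ) (hj : 0 ≤ j) : ∀ v ∈ S, phiD.mode j v ∈ S := by
    refine hspan fun l hl => ?_
    induction l with
    | nil =>
      rw [show phiD.mode j (monomialD []) = 0 from fockOp_vacuum _ _ hj]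
      exact S.zero_mem
    | cons n l ih =>
      rw [List.pairwise_cons] at hl
      rw [monomialD_cons, phiD_mode_apply]
      refine S.sub_mem ?_ (hcre n _ (ih hl.2))
      split_ifs
      · exact hmon hl.2
      · exact S.zero_mem
  -- The span contains the cyclic vacuum and is stable under creation and annihilation modes alike.
  refine Fock.eq_top_of_fockOp_mem S (hmon (l := []) List.Pairwise.nil) fun i v hv => ?_
  rcases le_or_gt 0 i with h | h
  · exact hann i h v hv
  · have := hcre (-i - 1).toNat v hv
    rwa [show -(((-i - 1).toNat : ℕ) : ℤ) - 1 = i by omega] at this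

theorem iSup_dgComponent : ⨆ m, dgComponent m = ⊤ := by
  rw [eq_top_iff, ← span_monomialD, Submodule.span_le]
  rintro _ ⟨l, hl, rfl⟩
  exact Submodule.mem_iSup_of_mem (dg l) (Submodule.subset_span ⟨l, hl, rfl, rfl⟩)

/-- The mode attached to `n` has index `-n-1`, of opposite parity: an even entry is a `q` mode and
lowers the charge, an odd one a `p` mode and raises it. -/
theorem current_zero_monomialD (l : List ℕ) :
    fermionsD.current 0 (monomialD l) = (dg l : ℂ) • monomialD l := by
  induction l with
  | nil => rw [monomialD_nil, fermionsD.current_vac 0 le_rfl]; simp [dg]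
  | cons n l ih =>
    rw [monomialD_cons]
    obtain ⟨k, rfl | rfl⟩ := n.even_or_odd'
    · have hdg : dg (2 * k :: l) = dg l - 1 := by
        unfold dg
        rw [List.countP_cons_of_neg (by simp), List.countP_cons_of_pos (by simp)]
        push_cast; ring
      rw [show -((2 * k : ℕ) : ℤ) - 1 = 2 * (-(k : ℤ) - 1) + 1 by push_cast; ring,
        ← fermionsD_q_mode, fermionsD.current_q_apply, ih, hdg, map_smul, zero_add, Int.cast_sub,
        sub_smul, Int.cast_one, one_smul]
    · have hdg : dg ((2 * k + 1) :: l) = dg l + 1 := by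
        unfold dg
        rw [List.countP_cons_of_pos (by simp), List.countP_cons_of_neg (by simp)]
        push_cast; ring
      rw [show -((2 * k + 1 : ℕ) : ℤ) - 1 = 2 * (-(k : ℤ) - 1) by push_cast; ring,
        ← fermionsD_p_mode, fermionsD.current_p_apply, ih, hdg, map_smul, zero_add, Int.cast_add,
        add_smul, Int.cast_one, one_smul]

theorem dgComponent_eq_sector (m : ℤ) : dgComponent m = fermionsD.sector m := by
  rw [fermionsD.sector_eq_eigenspace]
  refine congrFun (fermionsD.iSupIndep_eigenspace.eq_of_le_of_iSup_eq_top (fun m => ?_)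
    iSup_dgComponent) m
  refine Submodule.span_le.mpr ?_
  rintro _ ⟨l, -, rfl, rfl⟩
  exact Module.End.mem_eigenspace_iff.mpr (current_zero_monomialD l)

theorem monomialD_odd (n : ℕ) :
    monomialD ((List.range n).map fun i => 2 * i + 1).reverse = fermionsD.posVac n := by
  induction n with
  | zero => rfl
  | succ n ih =>
    rw [List.range_succ, List.map_append, List.reverse_append, List.map_singleton,
      List.reverse_singleton, List.singleton_append, monomialD_cons, ih, ChargedFermions.posVac,
      fermionsD_p_mode]
    congr 2
    push_cast; ring

theorem monomialD_even (n : ℕ) :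
    monomialD ((List.range n).map fun i => 2 * i).reverse = fermionsD.conj.posVac n := by
  induction n with
  | zero => rfl
  | succ n ih =>
    rw [List.range_succ, List.map_append, List.reverse_append, List.map_singleton,
      List.reverse_singleton, List.singleton_append, monomialD_cons, ih, ChargedFermions.posVac,
      show fermionsD.conj.p = fermionsD.q from rfl, fermionsD_q_mode]
    congr 2
    push_cast; ring

theorem topVector_eq_chargedVac (m : ℤ) : topVector m = fermionsD.chargedVac m := by
  cases m with
  | ofNat n => exact monomialD_odd n
  | negSucc n => exact monomialD_even (n + 1)

/-- Keeping `op` a variable allows the equality with the current to be substituted, although the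
module structures depend on `op`. -/
theorem ChargedFermions.exists_decomposition {V : Type*} [AddCommGroup V] [Module ℂ V]
    (C : ChargedFermions V) {W : Type*} [AddCommGroup W] [Module ℂ W] (D : ChargedFermions W)
    {op : ℤ → Module.End ℂ V} (hop : op = C.current) :
    ∃ (rel : HeisRel op) (F : ℤ → LieSubmodule ℂ HeisZ (HeisModule op rel)),
      (∀ (m : ℤ) (v : V), HeisModule.of op rel v ∈ F m ↔ v ∈ C.sector m) ∧
      DirectSum.IsInternal (fun m : ℤ => (F m).toSubmodule) ∧
      (∀ m : ℤ, LieModule.IsIrreducible ℂ HeisZ (F m)) ∧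
      (∀ m : ℤ, ∃ hv : HeisModule.of op rel (C.chargedVac m) ∈ F m,
        IsHeisHighestWeightVector (m : ℂ)
          (⟨HeisModule.of op rel (C.chargedVac m), hv⟩ : F m)) ∧
      (∀ m : ℤ, Nonempty (F m ≃ₗ⁅ℂ,HeisZ⁆ BosonModule (m : ℂ))) ∧
      Nonempty (HeisModule op rel ≃ₗ⁅ℂ,HeisZ⁆ (⨁ m : ℤ, BosonModule (m : ℂ))) ∧
      Nonempty (HeisModule op rel ≃ₗ⁅ℂ,HeisZ⁆ HeisModule D.current D.current_rel) := by
  subst hop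
  exact ⟨C.current_rel, fun m => (C.bosonHom m).range, C.mem_range_bosonHom,
    C.isInternal_range_bosonHom, C.isIrreducible_range_bosonHom,
    C.isHeisHighestWeightVector_chargedVac, fun m => ⟨(C.bosonEquiv m).symm⟩,
    ⟨C.directSumBosonEquiv.symm⟩, ⟨C.directSumBosonEquiv.symm.trans D.directSumBosonEquiv⟩⟩

end

theorem mainTheorem1 :
    ∃ (relD : HeisRel hD) (relA : HeisRel hA)
      (F : ℤ → LieSubmodule ℂ HeisZ (HeisModule hD relD)),
      (∀ (m : ℤ) (v : FockD), HeisModule.of hD relD v ∈ F m ↔ v ∈ dgComponent m) ∧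
      DirectSum.IsInternal (fun m : ℤ => (F m).toSubmodule) ∧
      (∀ m : ℤ, LieModule.IsIrreducible ℂ HeisZ (F m)) ∧
      (∀ m : ℤ, ∃ hv : HeisModule.of hD relD (topVector m) ∈ F m,
        IsHeisHighestWeightVector (m : ℂ)
          (⟨HeisModule.of hD relD (topVector m), hv⟩ : F m)) ∧
      (∀ m : ℤ, Nonempty (F m ≃ₗ⁅ℂ,HeisZ⁆ BosonModule (m : ℂ))) ∧
      Nonempty (HeisModule hD relD ≃ₗ⁅ℂ,HeisZ⁆ (⨁ m : ℤ, BosonModule (m : ℂ))) ∧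
      Nonempty (HeisModule hD relD ≃ₗ⁅ℂ,HeisZ⁆ HeisModule hA relA) := by
  obtain ⟨relD, F, hF, hrest⟩ := fermionsD.exists_decomposition fermionsA hD_eq_current
  simp only [← topVector_eq_chargedVac, ← dgComponent_eq_sector] at hF hrest
  -- `hA` is definitionally the current of `fermionsA`, unlike `hD`, which needed `hD_eq_current`.
  exact ⟨relD, fermionsA.current_rel, F, hF, hrest⟩
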